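/- Let $Z$ be an arbitrary abelian topological group, let $K$ be a topological group, and let $Z\hookrightarrow\hat K\to K$ be a central extension of topological groups which is a locally trivial principal $Z$-bundle. For a topological group $G$ let $\underline G$ be the sheaf of continuous $G$-valued functions, and let $\check H^\bullet$ denote Čech cohomology (the limit over all open covers). The class $[P]\in\check H^1(X,\underline G)$ of a principal $G$-bundle $P\to X$ (with $G$ acting from the right) is given by the transition functions $g_{ij}$ defined by $s_i=s_j\cdot g_{ij}$ for local sections $s_i$; so cocycles satisfy $g_{jk}g_{ij}=g_{ik}$. The connecting maps $\delta_0\colon C(X,K)\to\check H^1(X,\underline Z)$ and $\delta_1\colon\check H^1(X,\underline K)\to\check H^2(X,\underline Z)$ (for $X$ paracompact Hausdorff) are $\delta_0(f)=[\hat f_i\hat f_j^{-1}]$ and $\delta_1([g_{ij}])=[\hat g_{jk}\hat g_{ij}\hat g_{ik}^{-1}]$, where $\hat f_i$ and $\hat g_{ij}$ are continuous $\hat K$-valued lifts of $f$ and $g_{ij}$ on a sufficiently fine open cover. Realize $\mathbb S^n$ as the boundary of the simplex $\Delta^{n+1}=[e_0,\dots,e_{n+1}]$, and regard it as the boundary of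 the face $F=[e_0,\dots,e_{n+1}]$ of $\Delta^{n+2}$, hence as a subset (the equator) of $\mathbb S^{n+1}=\partial\Delta^{n+2}$. Let $C\subseteq\mathbb S^{n+1}$ be the union of the other faces, so that $\mathbb S^{n+1}=C\cup F$ and $C\cap F=\mathbb S^n$, and let $p\colon C\setminus\{e_{n+2}\}\to\mathbb S^n$ be the radial retraction. An open cover $(U_i)_{i\in I}$ of $\mathbb S^n$ yields the open cover of $\mathbb S^{n+1}$ consisting of $V_i=p^{-1}(U_i)\cup(F\setminus\mathbb S^n)$, $i\in I$, and of $V_\infty=\mathbb S^{n+1}\setminus F$. The suspension map $\Sigma_1\colon\check H^1(\mathbb S^n,\underline Z)\to\check H^2(\mathbb S^{n+1},\underline Z)$ sends $[z_{ij}]$ to $[h]$, where $h_{ij\infty}=z_{ij}\circ p$, $h_{i\infty j}=-z_{ij}\circ p$, $h_{\infty ij}=z_{ij}\circ p$ for $i,j\in I$, and $h=0$ at all other triples of indices. Likewise $\Sigma_0\colon C(\mathbb S^n,K)\to\check H^1(\mathbb S^{n+1},\underline K)$ sends $f$ to the class of the cocycle $h_{i\infty}=f\circ p$, $h_{\infty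 i}=(f\circ p)^{-1}$, $h_{ij}=h_{\infty\infty}=1$. For a continuous map $f\colon\mathbb S^n\to K$ let $P_f\to\mathbb S^{n+1}$ be the clutched principal $K$-bundle, that is, the quotient of $(C\times K)\sqcup(F\times K)$ in which, for each $x\in\mathbb S^n$ and $k\in K$, the point $(x,f(x)k)$ of $C\times K$ is identified with the point $(x,k)$ of $F\times K$. Then for every integer $n\ge 0$ and every continuous map $f\colon\mathbb S^n\to K$, $$\Sigma_0(f)=[P_f],\qquad \delta_1([P_f])=-\Sigma_1(\delta_0(f)),\qquad \delta_0(f)=[f^*\hat K],$$ so that in particular $\delta_1\circ\Sigma_0=-\Sigma_1\circ\delta_0$. -/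

import Mathlib

open Set Topology

set_option linter.unusedSectionVars false

universe u v w

/-! ### Čech cohomology in degrees one and two

Open covers of `X` are indexed by the points of `X`, with `x ∈ U x`; these covers are cofinal among
all open covers, and they are directed under pointwise inclusion, so that the limit over them is
the Čech cohomology of `X`. Partially defined functions are represented by total
functions; only their values on the indicated open sets matter. -/

/-- An open cover `(U x)` of `X` indexed by the points of `X`, with `x ∈ U x`. -/
structure PtCover (X : Type*) [TopologicalSpace X] where
  set : X → Set X
  isOpen : ∀ x, IsOpen (set x)
  mem : ∀ x, x ∈ set x

/-- The common refinement of two covers. -/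
def PtCover.inter {X : Type*} [TopologicalSpace X] (U V : PtCover X) : PtCover X where
  set x := U.set x ∩ V.set x
  isOpen x := (U.isOpen x).inter (V.isOpen x)
  mem x := ⟨U.mem x, V.mem x⟩

/-- A family of open neighbourhoods, one for each point, is a cover. -/
theorem exists_ptCover {X : Type*} [TopologicalSpace X] {p : X → Set X → Prop}
    (h : ∀ x, ∃ U, IsOpen U ∧ x ∈ U ∧ p x U) : ∃ U : PtCover X, ∀ x, p x (U.set x) := by
  choose U h1 h2 h3 using h
  exact ⟨⟨U, h1, h2⟩, h3⟩

section H1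

variable (X : Type*) [TopologicalSpace X] (G : Type*) [Group G] [TopologicalSpace G]

variable {X G} in
/-- `g` is a one-cocycle on the cover `U`, with values in the (not necessarily commutative) group
`G`: the `g i j` are continuous on `U i ∩ U j`, and they compose like the transition functions of
local sections `s i = s j • g i j` of a principal bundle with `G` acting from the right. -/
def IsCocycle1 (U : PtCover X) (g : X → X → X → G) : Prop :=
  (∀ i j, ContinuousOn (g i j) (U.set i ∩ U.set j)) ∧
    ∀ i j k, ∀ x ∈ U.set i ∩ U.set j ∩ U.set k, g j k x * g i j x = g i k x

/-- The one-cocycles on open covers of `X`. -/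
def Cocycle1 : Type _ := {g : X → X → X → G // ∃ U : PtCover X, IsCocycle1 U g}

variable {X G} in
/-- Two one-cocycles are cohomologous: after passing to a common refinement, they
differ by a change `s' i = s i • b i` of the local sections. -/
def Cohomologous1 (g h : X → X → X → G) : Prop :=
  ∃ (U : PtCover X) (b : X → X → G), (∀ i, ContinuousOn (b i) (U.set i)) ∧
    ∀ i j, ∀ x ∈ U.set i ∩ U.set j, h i j x = (b j x)⁻¹ * g i j x * b i x

/-- Being cohomologous is an equivalence relation. -/
def cocycle1Setoid [IsTopologicalGroup G] : Setoid (Cocycle1 X G) where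
  r g h := Cohomologous1 g.1 h.1
  iseqv := by
    refine ⟨fun g => ?_, ?_, ?_⟩
    · obtain ⟨U, hU⟩ := g.2
      exact ⟨U, fun _ _ => 1, fun i => continuousOn_const, fun i j x _ => by simp⟩
    · rintro g h ⟨U, b, hb, hgh⟩
      refine ⟨U, fun i x => (b i x)⁻¹, fun i => (hb i).inv, fun i j x hx => ?_⟩
      rw [hgh i j x hx]; group
    · rintro g h k ⟨U, b, hb, hgh⟩ ⟨V, c, hc, hhk⟩
      refine ⟨U.inter V, fun i x => b i x * c i x, fun i => ?_, fun i j x hx => ?_⟩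
      · exact ((hb i).mono inter_subset_left).mul ((hc i).mono inter_subset_right)
      · rw [hhk i j x ⟨hx.1.2, hx.2.2⟩, hgh i j x ⟨hx.1.1, hx.2.1⟩]; group

/-- The first Čech cohomology set of `X` with values in the sheaf of continuous functions into the
topological group `G`. -/
def CechH1 [IsTopologicalGroup G] : Type _ := Quotient (cocycle1Setoid X G)

variable {X G} in
/-- The class of a one-cocycle. -/
def CechH1.mk [IsTopologicalGroup G] (g : Cocycle1 X G) : CechH1 X G :=
  Quotient.mk (cocycle1Setoid X G) g

end H1

section H2

variable (X : Type*) [TopologicalSpace X] (Z : Type*) [CommGroup Z] [TopologicalSpace Z]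
  [IsTopologicalGroup Z]

variable {X Z} in
/-- `c` is a two-cocycle on the cover `U`, with values in the abelian group `Z`. -/
def IsCocycle2 (U : PtCover X) (c : X → X → X → X → Z) : Prop :=
  (∀ i j k, ContinuousOn (c i j k) (U.set i ∩ U.set j ∩ U.set k)) ∧
    ∀ i j k l, ∀ x ∈ U.set i ∩ U.set j ∩ U.set k ∩ U.set l,
      c j k l x * (c i k l x)⁻¹ * c i j l x * (c i j k x)⁻¹ = 1

variable {X Z} in
/-- `c` is, on the cover `U`, the coboundary of a one-cochain. -/
def IsCoboundary2 (U : PtCover X) (c : X → X → X → X → Z) : Prop :=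
  ∃ b : X → X → X → Z, (∀ i j, ContinuousOn (b i j) (U.set i ∩ U.set j)) ∧
    ∀ i j k, ∀ x ∈ U.set i ∩ U.set j ∩ U.set k,
      c i j k x = b j k x * (b i k x)⁻¹ * b i j x

/-- The group of two-cocycles on open covers of `X`. -/
def Cocycle2 : Subgroup (X → X → X → X → Z) where
  carrier := {c | ∃ U : PtCover X, IsCocycle2 U c}
  one_mem' := ⟨⟨fun _ => univ, fun _ => isOpen_univ, fun _ => mem_univ _⟩,
    fun _ _ _ => continuousOn_const, fun i j k l x _ => by simp⟩
  mul_mem' := by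
    rintro c d ⟨U, hU, hc⟩ ⟨V, hV, hd⟩
    refine ⟨U.inter V, fun i j k => ?_, fun i j k l x hx => ?_⟩
    · exact ((hU i j k).mono fun x hx => ⟨⟨hx.1.1.1, hx.1.2.1⟩, hx.2.1⟩).mul
        ((hV i j k).mono fun x hx => ⟨⟨hx.1.1.2, hx.1.2.2⟩, hx.2.2⟩)
    · have h1 := hc i j k l x ⟨⟨⟨hx.1.1.1.1, hx.1.1.2.1⟩, hx.1.2.1⟩, hx.2.1⟩
      have h2 := hd i j k l x ⟨⟨⟨hx.1.1.1.2, hx.1.1.2.2⟩, hx.1.2.2⟩, hx.2.2⟩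
      have h3 := congrArg₂ (· * ·) h1 h2
      simp only [mul_one] at h3
      rw [← h3]
      simp only [Pi.mul_apply, mul_inv]
      ac_rfl
  inv_mem' := by
    rintro c ⟨U, hU, hc⟩
    refine ⟨U, fun i j k => (hU i j k).inv, fun i j k l x hx => ?_⟩
    have h1 := congrArg (·⁻¹) (hc i j k l x hx)
    simp only [inv_one] at h1
    rw [← h1]
    simp only [Pi.inv_apply, mul_inv]

/-- The group of two-coboundaries: families which are coboundaries on some open cover. -/
def Coboundary2 : Subgroup (X → X → X → X → Z) where
  carrier := {c | ∃ U : PtCover X, IsCoboundary2 U c}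
  one_mem' := ⟨⟨fun _ => univ, fun _ => isOpen_univ, fun _ => mem_univ _⟩,
    fun _ _ _ => 1, fun _ _ => continuousOn_const, fun i j k x _ => by simp⟩
  mul_mem' := by
    rintro c d ⟨U, b, hb, hc⟩ ⟨V, b', hb', hd⟩
    refine ⟨U.inter V, fun i j x => b i j x * b' i j x, fun i j => ?_, fun i j k x hx => ?_⟩
    · exact ((hb i j).mono fun x hx => ⟨hx.1.1, hx.2.1⟩).mul
        ((hb' i j).mono fun x hx => ⟨hx.1.2, hx.2.2⟩)
    · have h1 := hc i j k x ⟨⟨hx.1.1.1, hx.1.2.1⟩, hx.2.1⟩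
      have h2 := hd i j k x ⟨⟨hx.1.1.2, hx.1.2.2⟩, hx.2.2⟩
      simp only [Pi.mul_apply, h1, h2, mul_inv]
      ac_rfl
  inv_mem' := by
    rintro c ⟨U, b, hb, hc⟩
    refine ⟨U, fun i j x => (b i j x)⁻¹, fun i j => (hb i j).inv, fun i j k x hx => ?_⟩
    simp only [Pi.inv_apply, hc i j k x hx, mul_inv]

/-- The second Čech cohomology group of `X`, written additively, with values in the sheaf of
continuous functions into the abelian topological group `Z`. -/
def CechH2 : Type _ := Additive (Cocycle2 X Z ⧸ (Coboundary2 X Z).subgroupOf (Cocycle2 X Z))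

noncomputable instance : AddCommGroup (CechH2 X Z) :=
  inferInstanceAs
    (AddCommGroup (Additive (Cocycle2 X Z ⧸ (Coboundary2 X Z).subgroupOf (Cocycle2 X Z))))

variable {X Z} in
/-- The class of a two-cocycle. -/
def CechH2.mk (c : Cocycle2 X Z) : CechH2 X Z :=
  Additive.ofMul (QuotientGroup.mk c)

variable {X Z} in
theorem CechH2.mk_eq_mk {c d : Cocycle2 X Z}
    (h : ∃ U : PtCover X, IsCoboundary2 U fun i j k x => (c.1 i j k x)⁻¹ * d.1 i j k x) :
    CechH2.mk c = CechH2.mk d := by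
  refine congrArg Additive.ofMul (QuotientGroup.eq.mpr ?_)
  rw [Subgroup.mem_subgroupOf]
  exact h

end H2

/-! ### Principal bundles -/

/-- `π : P → X` is a (locally trivial) principal bundle, where the group `G` acts on `P` from the
right by `act`: around every point of `X` there is an equivariant local trivialization. -/
def IsPrincipalBundle {X P G : Type*} [TopologicalSpace X] [TopologicalSpace P]
    [Group G] [TopologicalSpace G] (act : P → G → P) (π : P → X) : Prop :=
  ∀ x, ∃ e : Bundle.Trivialization G π, x ∈ e.baseSet ∧
    ∀ p g, π p ∈ e.baseSet → π (act p g) = π p ∧ (e (act p g)).2 = (e p).2 * g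

/-- Principal `G`-bundles over `X`. -/
structure PrincipalBundle (X : Type u) (G : Type v) [TopologicalSpace X] [Group G]
    [TopologicalSpace G] where
  /-- the total space -/
  Total : Type w
  [topology : TopologicalSpace Total]
  /-- the action of the structure group from the right -/
  act : Total → G → Total
  act_one : ∀ p, act p 1 = p
  act_mul : ∀ p g h, act p (g * h) = act (act p g) h
  /-- the projection -/
  proj : Total → X
  isPrincipal : IsPrincipalBundle act proj

attribute [instance] PrincipalBundle.topology

section BundleClass

variable {X : Type u} {G : Type v} [TopologicalSpace X] [Group G] [TopologicalSpace G]

theorem IsPrincipalBundle.exists_section {P : Type*} [TopologicalSpace P] {act : P → G → P}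
    {π : P → X} (h : IsPrincipalBundle act π) (x : X) :
    ∃ U, IsOpen U ∧ x ∈ U ∧ ∃ s : X → P, ContinuousOn s U ∧ ∀ y ∈ U, π (s y) = y := by
  obtain ⟨e, hx, -⟩ := h x
  refine ⟨e.baseSet, e.open_baseSet, hx, fun y => e.toOpenPartialHomeomorph.symm (y, 1), ?_, ?_⟩
  · refine e.continuousOn_invFun.comp (by fun_prop) fun y hy => ?_
    simpa [e.target_eq] using hy
  · intro y hy
    exact e.proj_symm_apply' hy

/-- The division map of a principal bundle is continuous. -/
theorem IsPrincipalBundle.exists_division [IsTopologicalGroup G] {P : Type*} [TopologicalSpace P]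
    {act : P → G → P} {π : P → X} (h : IsPrincipalBundle act π) {T : Type*} [TopologicalSpace T]
    {s t : T → P} {A : Set T} (hA : IsOpen A) (hs : ContinuousOn s A) (ht : ContinuousOn t A)
    (hst : ∀ a ∈ A, π (s a) = π (t a)) :
    ∃ g : T → G, ContinuousOn g A ∧ (∀ a ∈ A, s a = act (t a) (g a)) ∧
      ∀ a ∈ A, ∀ g' : G, s a = act (t a) g' → g' = g a := by
  choose e he1 he2 using h
  have key : ∀ x a, a ∈ A → π (t a) ∈ (e x).baseSet → ∀ g,
      s a = act (t a) g ↔ g = (e x (t a)).2⁻¹ * (e x (s a)).2 := by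
    intro x a ha hb g
    obtain ⟨h1, h2⟩ := he2 x (t a) g hb
    constructor
    · intro h; rw [h, h2]; group
    · intro h
      have hsx : s a ∈ (e x).source := by rw [(e x).mem_source, hst a ha]; exact hb
      have htx : act (t a) g ∈ (e x).source := by rw [(e x).mem_source, h1]; exact hb
      refine (e x).injOn hsx htx (Prod.ext ?_ ?_)
      · change ((e x) (s a)).1 = ((e x) (act (t a) g)).1
        rw [(e x).coe_fst hsx, (e x).coe_fst htx, h1, hst a ha]
      · change ((e x) (s a)).2 = ((e x) (act (t a) g)).2
        rw [h2, h]; group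
  refine ⟨fun a => (e (π (t a)) (t a)).2⁻¹ * (e (π (t a)) (s a)).2, ?_, ?_, ?_⟩
  · intro a ha
    have hta : t a ∈ (e (π (t a))).source := by rw [(e _).mem_source]; exact he1 _
    have hsa : s a ∈ (e (π (t a))).source := by rw [(e _).mem_source, hst a ha]; exact he1 _
    have c1 : ContinuousAt (fun b => (e (π (t a)) (t b)).2) a :=
      continuous_snd.continuousAt.comp
        (((e (π (t a))).continuousAt hta).comp (ht.continuousAt (hA.mem_nhds ha)))
    have c2 : ContinuousAt (fun b => (e (π (t a)) (s b)).2) a :=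
      continuous_snd.continuousAt.comp
        (((e (π (t a))).continuousAt hsa).comp (hs.continuousAt (hA.mem_nhds ha)))
    refine ((c1.inv.mul c2).congr ?_).continuousWithinAt
    have hn : ∀ᶠ b in 𝓝 a, t b ∈ (e (π (t a))).source :=
      (ht.continuousAt (hA.mem_nhds ha)).eventually_mem ((e (π (t a))).open_source.mem_nhds hta)
    filter_upwards [hn, hA.mem_nhds ha] with b hb hbA
    have hb' : π (t b) ∈ (e (π (t a))).baseSet := (e _).mem_source.mp hb
    exact (key _ b hbA (he1 _) _).mp ((key _ b hbA hb' _).mpr rfl)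
  · intro a ha
    exact (key _ a ha (he1 _) _).mpr rfl
  · intro a ha g' hg'
    exact (key _ a ha (he1 _) _).mp hg'

variable [IsTopologicalGroup G]

/-- `c` is the class given by transition functions `g i j`, where `s i = s j • g i j` for local
sections `s i` of the principal bundle `P`. -/
def PrincipalBundle.IsClass (P : PrincipalBundle.{u, v, w} X G) (c : CechH1 X G) : Prop :=
  ∃ (U : PtCover X) (s : X → X → P.Total), (∀ i, ContinuousOn (s i) (U.set i)) ∧
    (∀ i, ∀ x ∈ U.set i, P.proj (s i x) = x) ∧
    ∃ g : Cocycle1 X G, IsCocycle1 U g.1 ∧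
      (∀ i j, ∀ x ∈ U.set i ∩ U.set j, s i x = P.act (s j x) (g.1 i j x)) ∧ c = CechH1.mk g

theorem PrincipalBundle.exists_isClass (P : PrincipalBundle.{u, v, w} X G) :
    ∃ c, P.IsClass c := by
  obtain ⟨U, hU⟩ := exists_ptCover P.isPrincipal.exists_section
  choose s hs1 hs2 using hU
  have H : ∀ i j, ∃ g : X → G, ContinuousOn g (U.set i ∩ U.set j) ∧
      (∀ a ∈ U.set i ∩ U.set j, s i a = P.act (s j a) (g a)) ∧
      ∀ a ∈ U.set i ∩ U.set j, ∀ g', s i a = P.act (s j a) g' → g' = g a := fun i j =>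
    P.isPrincipal.exists_division ((U.isOpen i).inter (U.isOpen j))
      ((hs1 i).mono inter_subset_left) ((hs1 j).mono inter_subset_right)
      fun a ha => by rw [hs2 i a ha.1, hs2 j a ha.2]
  choose g hg1 hg2 hg3 using H
  have hc : IsCocycle1 U g := by
    refine ⟨hg1, fun i j k x hx => ?_⟩
    refine hg3 i k x ⟨hx.1.1, hx.2⟩ _ ?_
    rw [P.act_mul, ← hg2 j k x ⟨hx.1.2, hx.2⟩, ← hg2 i j x hx.1]
  exact ⟨_, U, s, hs1, hs2, ⟨g, U, hc⟩, hc, hg2, rfl⟩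

/-- The class of a principal bundle does not depend on the choice of local sections. -/
theorem PrincipalBundle.IsClass.unique {P : PrincipalBundle.{u, v, w} X G} {c c' : CechH1 X G}
    (h : P.IsClass c) (h' : P.IsClass c') : c = c' := by
  obtain ⟨U, s, hs1, hs2, g, hg, hsg, rfl⟩ := h
  obtain ⟨U', s', hs1', hs2', g', hg', hsg', rfl⟩ := h'
  have H : ∀ i, ∃ b : X → G, ContinuousOn b (U.set i ∩ U'.set i) ∧
      (∀ a ∈ U.set i ∩ U'.set i, s' i a = P.act (s i a) (b a)) ∧
      ∀ a ∈ U.set i ∩ U'.set i, ∀ b', s' i a = P.act (s i a) b' → b' = b a := fun i =>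
    P.isPrincipal.exists_division ((U.isOpen i).inter (U'.isOpen i))
      ((hs1' i).mono inter_subset_right) ((hs1 i).mono inter_subset_left)
      fun a ha => by rw [hs2' i a ha.2, hs2 i a ha.1]
  choose b hb1 hb2 hb3 using H
  refine Quotient.sound (s := cocycle1Setoid X G) ⟨U.inter U', b, hb1, fun i j x hx => ?_⟩
  have e : b j x * g'.1 i j x = g.1 i j x * b i x := by
    have h1 : s' i x = P.act (s j x) (b j x * g'.1 i j x) := by
      rw [P.act_mul, ← hb2 j x hx.2, ← hsg' i j x ⟨hx.1.2, hx.2.2⟩]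
    have h2 : s' i x = P.act (s j x) (g.1 i j x * b i x) := by
      rw [P.act_mul, ← hsg i j x ⟨hx.1.1, hx.2.1⟩, ← hb2 i x hx.1]
    obtain ⟨_, -, -, huniq⟩ := P.isPrincipal.exists_division (T := Unit) (s := fun _ => s' i x)
      (t := fun _ => s j x) isOpen_univ continuousOn_const continuousOn_const
      fun _ _ => by rw [hs2' i x hx.1.2, hs2 j x hx.2.1]
    exact (huniq () trivial _ h1).trans (huniq () trivial _ h2).symm
  rw [mul_assoc, ← e, inv_mul_cancel_left]

/-- The class `[P]` of a principal bundle in the first Čech cohomology. -/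
noncomputable def PrincipalBundle.cls (P : PrincipalBundle.{u, v, w} X G) : CechH1 X G :=
  P.exists_isClass.choose

end BundleClass

/-! ### Central extensions and connecting maps -/

/-- Central extensions `Z → K̂ → K` of topological groups which are locally trivial principal
`Z`-bundles. -/
structure CentralExtension (Z : Type u) (K : Type v) [CommGroup Z] [TopologicalSpace Z]
    [Group K] [TopologicalSpace K] where
  /-- the extension `K̂` -/
  Ext : Type w
  [group : Group Ext]
  [topology : TopologicalSpace Ext]
  [topologicalGroup : IsTopologicalGroup Ext]
  /-- the inclusion of the central subgroup -/
  incl : Z →* Ext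
  /-- the quotient map -/
  quot : Ext →* K
  continuous_incl : Continuous incl
  continuous_quot : Continuous quot
  incl_injective : Function.Injective incl
  quot_surjective : Function.Surjective quot
  range_eq_ker : incl.range = quot.ker
  central : ∀ z e, incl z * e = e * incl z
  locallyTrivial : IsPrincipalBundle (fun e z => e * incl z) quot

attribute [instance] CentralExtension.group CentralExtension.topology
  CentralExtension.topologicalGroup

section Connecting

variable {X : Type*} [TopologicalSpace X] {Z : Type u} {K : Type v} [CommGroup Z]
  [TopologicalSpace Z] [IsTopologicalGroup Z] [Group K] [TopologicalSpace K]
  [IsTopologicalGroup K]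

/-- `c` is the image of `f` under the connecting map in degree zero: it is represented by
`f̂ i * (f̂ j)⁻¹`, where the `f̂ i` are continuous local lifts of `f`. Since the difference is central,
its two factors commute. -/
def CentralExtension.IsConnecting0 (E : CentralExtension.{u, v, w} Z K) (f : C(X, K))
    (c : CechH1 X Z) : Prop :=
  ∃ (U : PtCover X) (fhat : X → X → E.Ext) (z : Cocycle1 X Z), IsCocycle1 U z.1 ∧
    (∀ i, ContinuousOn (fhat i) (U.set i)) ∧
    (∀ i, ∀ x ∈ U.set i, E.quot (fhat i x) = f x) ∧
    (∀ i j, ∀ x ∈ U.set i ∩ U.set j, E.incl (z.1 i j x) = fhat i x * (fhat j x)⁻¹) ∧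
    c = CechH1.mk z

theorem CentralExtension.exists_isConnecting0 (E : CentralExtension.{u, v, w} Z K)
    (f : C(X, K)) : ∃ c, E.IsConnecting0 f c := by
  have h : ∀ x, ∃ U, IsOpen U ∧ x ∈ U ∧ ∃ s : X → E.Ext, ContinuousOn s U ∧
      ∀ y ∈ U, E.quot (s y) = f y := by
    intro x
    obtain ⟨U, hU, hx, s, hs, hs'⟩ := E.locallyTrivial.exists_section (f x)
    exact ⟨f ⁻¹' U, hU.preimage f.continuous, hx, s ∘ f,
      hs.comp f.continuous.continuousOn fun y hy => hy, fun y hy => hs' _ hy⟩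
  obtain ⟨U, hU⟩ := exists_ptCover h
  choose s hs1 hs2 using hU
  have H : ∀ i j, ∃ g : X → Z, ContinuousOn g (U.set i ∩ U.set j) ∧
      (∀ a ∈ U.set i ∩ U.set j, s i a = s j a * E.incl (g a)) ∧
      ∀ a ∈ U.set i ∩ U.set j, ∀ g', s i a = s j a * E.incl g' → g' = g a := fun i j =>
    E.locallyTrivial.exists_division ((U.isOpen i).inter (U.isOpen j))
      ((hs1 i).mono inter_subset_left) ((hs1 j).mono inter_subset_right)
      fun a ha => by rw [hs2 i a ha.1, hs2 j a ha.2]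
  choose g hg1 hg2 hg3 using H
  have hc : IsCocycle1 U g := by
    refine ⟨hg1, fun i j k x hx => ?_⟩
    refine hg3 i k x ⟨hx.1.1, hx.2⟩ _ ?_
    rw [map_mul, ← mul_assoc, ← hg2 j k x ⟨hx.1.2, hx.2⟩, ← hg2 i j x hx.1]
  refine ⟨_, U, s, ⟨g, U, hc⟩, hc, hs1, hs2, fun i j x hx => ?_, rfl⟩
  rw [hg2 i j x hx, ← E.central]
  group

/-- The image under the connecting map in degree zero does not depend on the choice of lifts. -/
theorem CentralExtension.IsConnecting0.unique {E : CentralExtension.{u, v, w} Z K} {f : C(X, K)}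
    {c c' : CechH1 X Z} (h : E.IsConnecting0 f c) (h' : E.IsConnecting0 f c') : c = c' := by
  obtain ⟨U, s, z, hz, hs1, hs2, hsz, rfl⟩ := h
  obtain ⟨U', s', z', hz', hs1', hs2', hsz', rfl⟩ := h'
  have H : ∀ i, ∃ b : X → Z, ContinuousOn b (U.set i ∩ U'.set i) ∧
      (∀ a ∈ U.set i ∩ U'.set i, s' i a = s i a * E.incl (b a)) ∧
      ∀ a ∈ U.set i ∩ U'.set i, ∀ b', s' i a = s i a * E.incl b' → b' = b a := fun i =>
    E.locallyTrivial.exists_division ((U.isOpen i).inter (U'.isOpen i))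
      ((hs1' i).mono inter_subset_right) ((hs1 i).mono inter_subset_left)
      fun a ha => by rw [hs2' i a ha.2, hs2 i a ha.1]
  choose b hb1 hb2 hb3 using H
  refine Quotient.sound (s := cocycle1Setoid X Z) ⟨U.inter U', b, hb1, fun i j x hx => ?_⟩
  apply E.incl_injective
  have h1 : s i x * E.incl (b i x) * (s j x * E.incl (b j x))⁻¹ =
      s i x * (E.incl (b i x * (b j x)⁻¹) * (s j x)⁻¹) := by
    rw [map_mul, map_inv]; group
  rw [map_mul, map_mul, hsz' i j x ⟨hx.1.2, hx.2.2⟩, hsz i j x ⟨hx.1.1, hx.2.1⟩,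
    hb2 i x hx.1, hb2 j x hx.2, h1, E.central, E.central (b j x)⁻¹, mul_assoc _ (E.incl _),
    ← map_mul, mul_comm (b i x), mul_assoc]

/-- The connecting map `δ₀ : C(X, K) → Ȟ¹(X, Z)`. -/
noncomputable def CentralExtension.δ₀ (E : CentralExtension.{u, v, w} Z K) (f : C(X, K)) :
    CechH1 X Z :=
  (E.exists_isConnecting0 f).choose

/-- `d` is the image of `c` under the connecting map in degree one: `c` is represented by a
cocycle `g` with continuous lifts `ĝ i j`, and `d` is represented by the coboundary of `ĝ`, where the
factors are in the same order as in the cocycle condition `g j k * g i j = g i k`. -/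
def CentralExtension.IsConnecting1 (E : CentralExtension.{u, v, w} Z K) (c : CechH1 X K)
    (d : CechH2 X Z) : Prop :=
  ∃ (U : PtCover X) (g : Cocycle1 X K) (ghat : X → X → X → E.Ext) (z : Cocycle2 X Z),
    IsCocycle1 U g.1 ∧ c = CechH1.mk g ∧
    (∀ i j, ContinuousOn (ghat i j) (U.set i ∩ U.set j)) ∧
    (∀ i j, ∀ x ∈ U.set i ∩ U.set j, E.quot (ghat i j x) = g.1 i j x) ∧
    IsCocycle2 U z.1 ∧
    (∀ i j k, ∀ x ∈ U.set i ∩ U.set j ∩ U.set k,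
      E.incl (z.1 i j k x) = ghat j k x * ghat i j x * (ghat i k x)⁻¹) ∧
    d = CechH2.mk z

/-- On a paracompact Hausdorff space every one-cocycle can be refined to one which lifts. -/
theorem CentralExtension.exists_lift [ParacompactSpace X] [T2Space X]
    (E : CentralExtension.{u, v, w} Z K) (U : PtCover X) (g : X → X → X → K)
    (hg : IsCocycle1 U g) :
    ∃ (W : PtCover X) (r : X → X) (ghat : X → X → X → E.Ext),
      (∀ x, W.set x ⊆ U.set (r x)) ∧
      (∀ i j, ContinuousOn (ghat i j) (W.set i ∩ W.set j)) ∧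
      (∀ i j, ∀ x ∈ W.set i ∩ W.set j, E.quot (ghat i j x) = g (r i) (r j) x) := by
  classical
  obtain ⟨V, hVo, hVc, hVf, hVU⟩ := precise_refinement U.set U.isOpen
    (eq_univ_of_forall fun x => mem_iUnion.mpr ⟨x, U.mem x⟩)
  obtain ⟨V', hVc', hVo', hVV'⟩ := exists_iUnion_eq_closure_subset hVo hVf.point_finite hVc
  have hr : ∀ x, ∃ i, x ∈ V' i := fun x => mem_iUnion.mp (hVc' ▸ mem_univ x)
  choose r hr using hr
  have hsub : ∀ i, V' i ⊆ U.set i := fun i => subset_closure.trans ((hVV' i).trans (hVU i))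
  have h1 : ∀ x j, ∃ W, IsOpen W ∧ x ∈ W ∧ ((W ∩ V' j).Nonempty →
      ∃ l : X → E.Ext, ContinuousOn l W ∧ ∀ y ∈ W, E.quot (l y) = g (r x) j y) := by
    intro x j
    by_cases hx : x ∈ closure (V' j)
    · have hxj : x ∈ U.set (r x) ∩ U.set j := ⟨hsub _ (hr x), hVU j (hVV' j hx)⟩
      obtain ⟨O, hO, hxO, s, hs, hs'⟩ := E.locallyTrivial.exists_section (g (r x) j x)
      refine ⟨(U.set (r x) ∩ U.set j) ∩ g (r x) j ⁻¹' O,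
        (hg.1 (r x) j).isOpen_inter_preimage ((U.isOpen _).inter (U.isOpen _)) hO,
        ⟨hxj, hxO⟩, fun _ => ⟨s ∘ g (r x) j, ?_, fun y hy => hs' _ hy.2⟩⟩
      exact hs.comp ((hg.1 (r x) j).mono inter_subset_left) fun y hy => hy.2
    · refine ⟨(closure (V' j))ᶜ, isClosed_closure.isOpen_compl, hx, ?_⟩
      rintro ⟨y, hy, hy'⟩
      exact absurd (subset_closure hy') hy
  choose N hNo hNx hNl using h1
  have h2 : ∀ x, ∃ W, IsOpen W ∧ x ∈ W ∧ W ⊆ V' (r x) ∧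
      ∀ j, (W ∩ V' j).Nonempty → W ⊆ N x j := by
    intro x
    obtain ⟨t, ht, htf⟩ := hVf x
    refine ⟨interior t ∩ V' (r x) ∩ ⋂ j ∈ {j | (V j ∩ t).Nonempty}, N x j, ?_, ?_, ?_, ?_⟩
    · exact (isOpen_interior.inter (hVo' _)).inter (htf.isOpen_biInter fun j _ => hNo x j)
    · exact ⟨⟨mem_interior_iff_mem_nhds.mpr ht, hr x⟩, mem_iInter₂.mpr fun j _ => hNx x j⟩
    · exact fun y hy => hy.1.2
    · rintro j ⟨y, hy, hyj⟩ a ha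
      exact mem_iInter₂.mp ha.2 j ⟨y, hVV' j (subset_closure hyj), interior_subset hy.1.1⟩
  choose W hWo hWx hWr hWN using h2
  have h3 : ∀ i j, ∃ l : X → E.Ext, ContinuousOn l (W i ∩ W j) ∧
      ∀ x ∈ W i ∩ W j, E.quot (l x) = g (r i) (r j) x := by
    intro i j
    by_cases hne : (W i ∩ W j).Nonempty
    · have hne' : (W i ∩ V' (r j)).Nonempty := hne.mono fun y hy => ⟨hy.1, hWr j hy.2⟩
      have hsubN := hWN i (r j) hne'
      obtain ⟨l, hl, hl'⟩ := hNl i (r j) (hne'.mono fun y hy => ⟨hsubN hy.1, hy.2⟩)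
      exact ⟨l, hl.mono fun y hy => hsubN hy.1, fun y hy => hl' y (hsubN hy.1)⟩
    · rw [not_nonempty_iff_eq_empty] at hne
      exact ⟨fun _ => 1, continuousOn_const, fun x hx => by simp [hne] at hx⟩
  choose ghat hghat1 hghat2 using h3
  exact ⟨⟨W, hWo, hWx⟩, r, ghat, fun x => (hWr x).trans (hsub _), hghat1, hghat2⟩

theorem CentralExtension.exists_isConnecting1 [ParacompactSpace X] [T2Space X]
    (E : CentralExtension.{u, v, w} Z K) (c : CechH1 X K) : ∃ d, E.IsConnecting1 c d := by
  obtain ⟨⟨g, U, hg⟩, rfl⟩ := Quotient.exists_rep c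
  obtain ⟨W, r, s, hWr, hs1, hs2⟩ := E.exists_lift U g hg
  have hg' : IsCocycle1 W fun i j => g (r i) (r j) :=
    ⟨fun i j => (hg.1 _ _).mono (inter_subset_inter (hWr i) (hWr j)),
      fun i j k x hx => hg.2 _ _ _ x ⟨⟨hWr _ hx.1.1, hWr _ hx.1.2⟩, hWr _ hx.2⟩⟩
  have hcoh : Cohomologous1 g fun i j => g (r i) (r j) := by
    refine ⟨U.inter W, fun i => g (r i) i, fun i => ?_, fun i j x hx => ?_⟩
    · exact (hg.1 _ _).mono fun x hx => ⟨hWr i hx.2, hx.1⟩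
    · have h1 := hg.2 (r i) i j x ⟨⟨hWr i hx.1.2, hx.1.1⟩, hx.2.1⟩
      have h2 := hg.2 (r i) (r j) j x ⟨⟨hWr i hx.1.2, hWr j hx.2.2⟩, hx.2.1⟩
      rw [mul_assoc, h1, ← h2]
      group
  have hmul : ∀ i j k, ∀ x ∈ W.set i ∩ W.set j ∩ W.set k,
      E.quot (s j k x * s i j x) = E.quot (s i k x) := by
    intro i j k x hx
    rw [map_mul, hs2 j k x ⟨hx.1.2, hx.2⟩, hs2 i j x hx.1, hs2 i k x ⟨hx.1.1, hx.2⟩]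
    exact hg'.2 i j k x hx
  have H : ∀ i j k, ∃ z : X → Z, ContinuousOn z (W.set i ∩ W.set j ∩ W.set k) ∧
      (∀ a ∈ W.set i ∩ W.set j ∩ W.set k, s j k a * s i j a = s i k a * E.incl (z a)) ∧
      ∀ a ∈ W.set i ∩ W.set j ∩ W.set k, ∀ z',
        s j k a * s i j a = s i k a * E.incl z' → z' = z a := fun i j k =>
    E.locallyTrivial.exists_division (((W.isOpen i).inter (W.isOpen j)).inter (W.isOpen k))
      (s := fun a => s j k a * s i j a) (t := s i k)
      (((hs1 j k).mono fun x hx => ⟨hx.1.2, hx.2⟩).mul ((hs1 i j).mono fun x hx => hx.1))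
      ((hs1 i k).mono fun x hx => ⟨hx.1.1, hx.2⟩) (hmul i j k)
  choose z hz1 hz2 hz3 using H
  have hz : IsCocycle2 W z := by
    refine ⟨hz1, fun i j k l x hx => ?_⟩
    have e1 := hz2 j k l x ⟨⟨hx.1.1.2, hx.1.2⟩, hx.2⟩
    have e2 := hz2 i j l x ⟨hx.1.1, hx.2⟩
    have e3 := hz2 i j k x hx.1
    have e4 := hz2 i k l x ⟨⟨hx.1.1.1, hx.1.2⟩, hx.2⟩
    have e5 : s i l x * E.incl (z i j l x * z j k l x) =
        s i l x * E.incl (z i k l x * z i j k x) := by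
      calc s i l x * E.incl (z i j l x * z j k l x)
          = s j l x * E.incl (z j k l x) * s i j x := by
            rw [map_mul, ← mul_assoc, ← e2, mul_assoc, mul_assoc, E.central]
        _ = s k l x * (s j k x * s i j x) := by rw [← e1, mul_assoc]
        _ = s i l x * E.incl (z i k l x * z i j k x) := by
            rw [e3, ← mul_assoc, e4, map_mul, mul_assoc]
    have e6 := E.incl_injective (mul_left_cancel e5)
    calc z j k l x * (z i k l x)⁻¹ * z i j l x * (z i j k x)⁻¹
        = (z i j l x * z j k l x) * (z i k l x * z i j k x)⁻¹ := by
          rw [mul_inv]; ac_rfl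
      _ = 1 := by rw [e6, mul_inv_cancel]
  refine ⟨_, W, ⟨_, W, hg'⟩, s, ⟨z, W, hz⟩, hg', ?_, hs1, hs2, hz, fun i j k x hx => ?_, rfl⟩
  · exact Quotient.sound (s := cocycle1Setoid X K) hcoh
  · rw [hz2 i j k x hx, ← E.central]
    group

/-- The image under the connecting map in degree one does not depend on any choices. -/
theorem CentralExtension.IsConnecting1.unique {E : CentralExtension.{u, v, w} Z K}
    {c : CechH1 X K} {d d' : CechH2 X Z} (h : E.IsConnecting1 c d) (h' : E.IsConnecting1 c d') :
    d = d' := by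
  obtain ⟨U, g, s, z, hg, rfl, hs1, hs2, hz, hsz, rfl⟩ := h
  obtain ⟨U', g', s', z', hg', hgg', hs1', hs2', hz', hsz', rfl⟩ := h'
  obtain ⟨V, b, hb, hgb⟩ : Cohomologous1 g.1 g'.1 := Quotient.exact (s := cocycle1Setoid X K) hgg'
  have h : ∀ x, ∃ W, IsOpen W ∧ x ∈ W ∧ W ⊆ U.set x ∩ U'.set x ∩ V.set x ∧
      ∃ l : X → E.Ext, ContinuousOn l W ∧ ∀ y ∈ W, E.quot (l y) = b x y := by
    intro x
    obtain ⟨O, hO, hxO, t, ht, ht'⟩ := E.locallyTrivial.exists_section (b x x)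
    refine ⟨(U.set x ∩ U'.set x) ∩ (V.set x ∩ b x ⁻¹' O), ((U.isOpen x).inter (U'.isOpen x)).inter
      ((hb x).isOpen_inter_preimage (V.isOpen x) hO), ⟨⟨U.mem x, U'.mem x⟩, V.mem x, hxO⟩,
      fun y hy => ⟨hy.1, hy.2.1⟩, t ∘ b x, ?_, fun y hy => ht' _ hy.2.2⟩
    exact ht.comp ((hb x).mono fun y hy => hy.2.1) fun y hy => hy.2.2
  obtain ⟨W, hW⟩ := exists_ptCover h
  choose hWs l hl1 hl2 using hW
  have H : ∀ i j, ∃ w : X → Z, ContinuousOn w (W.set i ∩ W.set j) ∧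
      (∀ a ∈ W.set i ∩ W.set j, s' i j a = (l j a)⁻¹ * s i j a * l i a * E.incl (w a)) ∧
      ∀ a ∈ W.set i ∩ W.set j, ∀ w',
        s' i j a = (l j a)⁻¹ * s i j a * l i a * E.incl w' → w' = w a := fun i j =>
    E.locallyTrivial.exists_division ((W.isOpen i).inter (W.isOpen j))
      (s := s' i j) (t := fun a => (l j a)⁻¹ * s i j a * l i a)
      ((hs1' i j).mono fun a ha => ⟨(hWs i ha.1).1.2, (hWs j ha.2).1.2⟩)
      ((((hl1 j).mono inter_subset_right).inv.mul
        ((hs1 i j).mono fun a ha => ⟨(hWs i ha.1).1.1, (hWs j ha.2).1.1⟩)).mul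
        ((hl1 i).mono inter_subset_left))
      fun a ha => by
        rw [hs2' i j a ⟨(hWs i ha.1).1.2, (hWs j ha.2).1.2⟩, map_mul, map_mul, map_inv,
          hs2 i j a ⟨(hWs i ha.1).1.1, (hWs j ha.2).1.1⟩, hl2 i a ha.1, hl2 j a ha.2,
          hgb i j a ⟨(hWs i ha.1).2, (hWs j ha.2).2⟩]
  choose w hw1 hw2 hw3 using H
  refine CechH2.mk_eq_mk ⟨W, w, hw1, fun i j k x hx => ?_⟩
  have e1 := hsz i j k x ⟨⟨(hWs i hx.1.1).1.1, (hWs j hx.1.2).1.1⟩, (hWs k hx.2).1.1⟩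
  have e2 := hsz' i j k x ⟨⟨(hWs i hx.1.1).1.2, (hWs j hx.1.2).1.2⟩, (hWs k hx.2).1.2⟩
  have f1 := hw2 i j x hx.1
  have f2 := hw2 j k x ⟨hx.1.2, hx.2⟩
  have f3 := hw2 i k x ⟨hx.1.1, hx.2⟩
  have e3 : E.incl (z'.1 i j k x) * E.incl (w i k x) =
      E.incl (z.1 i j k x) * (E.incl (w j k x) * E.incl (w i j x)) := by
    have e4 : s' j k x * s' i j x = E.incl (z'.1 i j k x) * s' i k x := by
      rw [e2]; group
    have e5 : s j k x * s i j x = E.incl (z.1 i j k x) * s i k x := by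
      rw [e1]; group
    have e6 : s' j k x * s' i j x = (l k x)⁻¹ * (s j k x * s i j x) * l i x *
        (E.incl (w j k x) * E.incl (w i j x)) := by
      rw [f1, f2, mul_assoc ((l k x)⁻¹ * s j k x * l j x), ← mul_assoc (E.incl (w j k x)),
        E.central (w j k x)]
      group
    rw [e4, e5, f3] at e6
    have e7 : (l k x)⁻¹ * (E.incl (z.1 i j k x) * s i k x) * l i x =
        E.incl (z.1 i j k x) * ((l k x)⁻¹ * s i k x * l i x) := by
      rw [← mul_assoc, ← E.central]; group
    rw [e7, E.central, E.central (z.1 i j k x), mul_assoc, mul_assoc _ (E.incl (z.1 i j k x)),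
      mul_left_cancel_iff] at e6
    rw [E.central]
    exact e6
  rw [← map_mul, ← map_mul, ← map_mul] at e3
  have e8 := E.incl_injective e3
  change (z.1 i j k x)⁻¹ * z'.1 i j k x = _
  rw [eq_mul_inv_of_mul_eq e8, mul_assoc, inv_mul_cancel_left]
  ac_rfl

/-- The connecting map `δ₁ : Ȟ¹(X, K) → Ȟ²(X, Z)` over a paracompact Hausdorff space. -/
noncomputable def CentralExtension.δ₁ [ParacompactSpace X] [T2Space X]
    (E : CentralExtension.{u, v, w} Z K) (c : CechH1 X K) : CechH2 X Z :=
  (E.exists_isConnecting1 c).choose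

end Connecting

/-! ### The pulled back bundle -/

/-- A local trivialization built from a local section and a fibre coordinate. -/
theorem exists_trivialization_of_section {X P G : Type*} [TopologicalSpace X]
    [TopologicalSpace P] [Group G] [TopologicalSpace G] {act : P → G → P} {π : P → X}
    (hπ : Continuous π) (hact : ∀ p g, π (act p g) = π p) {B : Set X} (hB : IsOpen B)
    (σ : X → P) (κ : P → G) (hσ : ∀ x ∈ B, π (σ x) = x)
    (hσc : ContinuousOn (fun q : X × G => act (σ q.1) q.2) (B ×ˢ univ))
    (hκc : ContinuousOn κ (π ⁻¹' B)) (hκ : ∀ x ∈ B, ∀ g, κ (act (σ x) g) = g)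
    (hσκ : ∀ p, π p ∈ B → act (σ (π p)) (κ p) = p)
    (hκg : ∀ p g, π p ∈ B → κ (act p g) = κ p * g) :
    ∃ e : Bundle.Trivialization G π, e.baseSet = B ∧
      ∀ p g, π p ∈ e.baseSet → π (act p g) = π p ∧ (e (act p g)).2 = (e p).2 * g := by
  refine ⟨{ toFun := fun p => (π p, κ p)
            invFun := fun q => act (σ q.1) q.2
            source := π ⁻¹' B
            target := B ×ˢ univ
            map_source' := fun p hp => ⟨hp, mem_univ _⟩
            map_target' := fun q hq => ?_
            left_inv' := fun p hp => hσκ p hp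
            right_inv' := fun q hq => ?_
            open_source := hB.preimage hπ
            open_target := hB.prod isOpen_univ
            continuousOn_toFun := hπ.continuousOn.prodMk hκc
            continuousOn_invFun := hσc
            baseSet := B
            open_baseSet := hB
            source_eq := rfl
            target_eq := rfl
            proj_toFun := fun p hp => rfl }, rfl, fun p g hp => ⟨hact p g, hκg p g hp⟩⟩
  · change π (act (σ q.1) q.2) ∈ B
    rw [hact, hσ _ hq.1]
    exact hq.1
  · refine Prod.ext ?_ (hκ _ hq.1 _)
    change π (act (σ q.1) q.2) = q.1
    rw [hact, hσ _ hq.1]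

section Pullback

variable {X : Type*} [TopologicalSpace X] {Z : Type u} {K : Type v} [CommGroup Z]
  [TopologicalSpace Z] [Group K] [TopologicalSpace K]

theorem CentralExtension.quot_incl (E : CentralExtension.{u, v, w} Z K) (z : Z) :
    E.quot (E.incl z) = 1 := by
  have h : E.incl z ∈ E.incl.range := ⟨z, rfl⟩
  rw [E.range_eq_ker] at h
  exact h

/-- The action of `Z` on the fibre product of `X` and `K̂` over `K`. -/
def CentralExtension.pullbackAct (E : CentralExtension.{u, v, w} Z K) (f : C(X, K))
    (p : {p : X × E.Ext // E.quot p.2 = f p.1}) (z : Z) :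
    {p : X × E.Ext // E.quot p.2 = f p.1} :=
  ⟨(p.1.1, p.1.2 * E.incl z), by rw [map_mul, E.quot_incl, mul_one]; exact p.2⟩

/-- The principal `Z`-bundle `f^* K̂` over `X`. -/
def CentralExtension.pullback [IsTopologicalGroup Z] (E : CentralExtension.{u, v, w} Z K)
    (f : C(X, K)) : PrincipalBundle X Z where
  Total := {p : X × E.Ext // E.quot p.2 = f p.1}
  act := E.pullbackAct f
  act_one p := by simp [pullbackAct]
  act_mul p z w := by simp [pullbackAct, mul_assoc]
  proj p := p.1.1
  isPrincipal := by
    intro x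
    obtain ⟨e, hx, he⟩ := E.locallyTrivial (f x)
    classical
    obtain ⟨s, hs⟩ : ∃ s : X → E.Ext, ∀ y, E.quot (s y) = f y ∧
        (f y ∈ e.baseSet → s y = e.toOpenPartialHomeomorph.symm (f y, 1)) := by
      refine ⟨fun y => if f y ∈ e.baseSet then e.toOpenPartialHomeomorph.symm (f y, 1)
        else (E.quot_surjective (f y)).choose, fun y => ?_⟩
      by_cases hy : f y ∈ e.baseSet
      · simp only [hy, if_true, true_implies, and_true]
        exact e.proj_symm_apply' hy
      · simp only [hy, if_false, false_implies, and_true]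
        exact (E.quot_surjective (f y)).choose_spec
    have hsc : ContinuousOn s (f ⁻¹' e.baseSet) := by
      have h : ContinuousOn (fun y => e.toOpenPartialHomeomorph.symm (f y, 1))
          (f ⁻¹' e.baseSet) := by
        refine e.continuousOn_invFun.comp (by fun_prop) fun y hy => ?_
        simpa [e.target_eq] using hy
      exact h.congr fun y hy => (hs y).2 hy
    have hes : ∀ y, f y ∈ e.baseSet → (e (s y)).2 = 1 := by
      intro y hy
      rw [(hs y).2 hy]
      exact congrArg Prod.snd (e.apply_symm_apply' hy)
    refine Exists.elim (exists_trivialization_of_section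
      (act := E.pullbackAct f)
      (π := fun p => p.1.1) (by fun_prop) (fun _ _ => rfl)
      (e.open_baseSet.preimage f.continuous) (fun y => ⟨(y, s y), (hs y).1⟩)
      (fun p => (e p.1.2).2) (fun _ _ => rfl) ?_ ?_ ?_ ?_ ?_)
      fun e' h => ⟨e', h.1 ▸ hx, h.2⟩
    · refine (Topology.IsInducing.subtypeVal.continuousOn_iff).mpr ?_
      refine ContinuousOn.prodMk continuousOn_fst (ContinuousOn.mul ?_ ?_)
      · exact hsc.comp continuousOn_fst fun q hq => hq.1
      · exact E.continuous_incl.comp_continuousOn continuousOn_snd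
    · refine continuousOn_snd.comp
        (t := univ) (e.continuousOn_toFun.comp
          (by fun_prop : Continuous fun p : {p : X × E.Ext // E.quot p.2 = f p.1} =>
            p.1.2).continuousOn fun p hp => ?_) fun _ _ => mem_univ _
      rw [e.source_eq]
      change E.quot p.1.2 ∈ e.baseSet
      rw [p.2]
      exact hp
    · intro y hy z
      change (e (s y * E.incl z)).2 = z
      rw [(he (s y) z (by rw [(hs y).1]; exact hy)).2, hes y hy, one_mul]
    · rintro ⟨⟨y, a⟩, ha⟩ hy
      refine Subtype.ext (Prod.ext rfl ?_)
      change s y * E.incl (e a).2 = a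
      have hy' : E.quot (s y) ∈ e.baseSet := by rw [(hs y).1]; exact hy
      have h := he (s y) (e a).2 hy'
      have ha1 : a ∈ e.source := by rw [e.mem_source, ha]; exact hy
      have ha2 : s y * E.incl (e a).2 ∈ e.source := by rw [e.mem_source, h.1]; exact hy'
      refine e.injOn ha2 ha1 (Prod.ext ?_ ?_)
      · change (e (s y * E.incl (e a).2)).1 = (e a).1
        rw [e.coe_fst ha2, e.coe_fst ha1, h.1, (hs y).1, ha]
      · change (e (s y * E.incl (e a).2)).2 = (e a).2
        rw [h.2, hes y hy, one_mul]
    · rintro ⟨⟨y, a⟩, ha⟩ z hy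
      exact (he a z (by rw [ha]; exact hy)).2

end Pullback

/-! ### Spheres as boundaries of simplices -/

/-- The sphere of dimension `n`, realized as the boundary of the standard simplex with vertices
`e₀, …, eₙ₊₁`. -/
abbrev SimplexSphere (n : ℕ) : Type :=
  {x : Fin (n + 2) → ℝ // x ∈ stdSimplex ℝ (Fin (n + 2)) ∧ ∃ i, x i = 0}

namespace SimplexSphere

theorem continuous_coord {n : ℕ} (i : Fin (n + 2)) :
    Continuous fun y : SimplexSphere n => y.1 i :=
  (continuous_apply i).comp continuous_subtype_val

instance (n : ℕ) : CompactSpace (SimplexSphere n) := by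
  have h : IsClosed {x : Fin (n + 2) → ℝ | ∃ i, x i = 0} := by
    rw [ofPred_exists]
    exact isClosed_iUnion_of_finite fun i => isClosed_eq (continuous_apply i) continuous_const
  exact isCompact_iff_compactSpace.mp ((isCompact_stdSimplex ℝ (Fin (n + 2))).inter_right h)

/-- The vertex `e₀`. -/
instance (n : ℕ) : Inhabited (SimplexSphere n) :=
  ⟨⟨Pi.single 0 1, single_mem_stdSimplex ℝ 0, 1, by simp⟩⟩

variable {n : ℕ}

/-- The last barycentric coordinate. -/
def height (y : SimplexSphere (n + 1)) : ℝ := y.1 (Fin.last (n + 2))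

theorem continuous_height : Continuous (height (n := n)) := continuous_coord _

/-- The union of the faces which contain the last vertex. -/
def cone (n : ℕ) : Set (SimplexSphere (n + 1)) := {y | ∃ i : Fin (n + 2), y.1 i.castSucc = 0}

/-- The face opposite to the last vertex. -/
def face (n : ℕ) : Set (SimplexSphere (n + 1)) := {y | height y = 0}

theorem isClosed_cone : IsClosed (cone n) := by
  rw [cone, ofPred_exists]
  exact isClosed_iUnion_of_finite fun i => isClosed_eq (continuous_coord _) continuous_const

theorem isClosed_face : IsClosed (face n) := isClosed_eq continuous_height continuous_const

theorem cone_union_face (y : SimplexSphere (n + 1)) : y ∈ cone n ∨ y ∈ face n := by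
  obtain ⟨i, hi⟩ := y.2.2
  induction i using Fin.lastCases with
  | last => exact Or.inr hi
  | cast i => exact Or.inl ⟨i, hi⟩

theorem height_nonneg (y : SimplexSphere (n + 1)) : 0 ≤ height y := y.2.1.1 _

theorem height_le_one (y : SimplexSphere (n + 1)) : height y ≤ 1 :=
  (mem_Icc_of_mem_stdSimplex y.2.1 _).2

theorem mem_cone_of_height_pos {y : SimplexSphere (n + 1)} (h : 0 < height y) : y ∈ cone n :=
  (cone_union_face y).resolve_right h.ne'

/-- The identification of the sphere of dimension `n` with the equator, that is, with the
boundary of the last face. -/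
def equator (x : SimplexSphere n) : SimplexSphere (n + 1) :=
  ⟨Fin.snoc (α := fun _ => ℝ) x.1 0, by
    refine ⟨⟨fun i => ?_, ?_⟩, Fin.last _, by simp⟩
    · induction i using Fin.lastCases with
      | last => simp
      | cast i => simpa using x.2.1.1 i
    · rw [Fin.sum_univ_castSucc]
      simpa using x.2.1.2⟩

theorem equator_mem_face (x : SimplexSphere n) : equator x ∈ face n := by
  simp [face, height, equator]

theorem equator_mem_cone (x : SimplexSphere n) : equator x ∈ cone n := by
  obtain ⟨i, hi⟩ := x.2.2
  exact ⟨i, by simpa [equator] using hi⟩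

theorem height_equator (x : SimplexSphere n) : height (equator x) = 0 := equator_mem_face x

open Classical in
/-- The radial retraction from the last vertex `e`, from the cone without `e` onto the equator.
Outside of its domain it has a junk value. -/
noncomputable def retract (y : SimplexSphere (n + 1)) : SimplexSphere n :=
  if h : y ∈ cone n ∧ height y ≠ 1 then
    ⟨fun i => y.1 i.castSucc / (1 - height y), by
      have h1 : 0 < 1 - height y := sub_pos.mpr (lt_of_le_of_ne (height_le_one y) h.2)
      refine ⟨⟨fun i => div_nonneg (y.2.1.1 _) h1.le, ?_⟩, ?_⟩
      · rw [← Finset.sum_div, div_eq_one_iff_eq h1.ne', eq_sub_iff_add_eq]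
        have := y.2.1.2
        rwa [Fin.sum_univ_castSucc] at this
      · obtain ⟨i, hi⟩ := h.1
        exact ⟨i, by simp [hi]⟩⟩
  else default

theorem retract_coord {y : SimplexSphere (n + 1)} (h : y ∈ cone n) (h' : height y ≠ 1)
    (i : Fin (n + 2)) : (retract y).1 i = y.1 i.castSucc / (1 - height y) := by
  rw [retract, dif_pos ⟨h, h'⟩]

theorem continuousOn_retract : ContinuousOn (retract (n := n)) (cone n ∩ {y | height y ≠ 1}) := by
  refine (Topology.IsInducing.subtypeVal.continuousOn_iff).mpr ?_
  refine continuousOn_pi.mpr fun i => ?_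
  have h : ContinuousOn (fun y : SimplexSphere (n + 1) => y.1 i.castSucc / (1 - height y))
      (cone n ∩ {y | height y ≠ 1}) :=
    (continuous_coord _).continuousOn.div
      (continuous_const.sub continuous_height).continuousOn
      fun y hy => sub_ne_zero.mpr (Ne.symm hy.2)
  exact h.congr fun y hy => retract_coord hy.1 hy.2 i

theorem retract_equator (x : SimplexSphere n) : retract (equator x) = x := by
  refine Subtype.ext (funext fun i => ?_)
  rw [retract_coord (equator_mem_cone x) (by simp [height_equator]), height_equator]
  simp [equator]

theorem equator_retract {y : SimplexSphere (n + 1)} (h : y ∈ cone n) (h' : y ∈ face n) :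
    equator (retract y) = y := by
  have h0 : height y = 0 := h'
  refine Subtype.ext (funext fun i => ?_)
  induction i using Fin.lastCases with
  | last => simpa [equator, height] using h0.symm
  | cast i => simp [equator, retract_coord h (by simp [h0]) i, h0]

/-! ### The suspension maps

A cover `(U a)` of the sphere induces a cover of the sphere in the next dimension which has one
more index, `none`. When the `U a` are the sets `{x | 0 < x i}`, it consists again of the sets
`{y | 0 < y i}`, with `none` corresponding to the last index. -/

/-- The sets of the suspended cover: `none` gives the star of the last vertex, and `some a` gives
the interior of the last face together with the preimage of `U a` under the retraction. -/
def suspSet (U : SimplexSphere n → Set (SimplexSphere n)) :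
    Option (SimplexSphere n) → Set (SimplexSphere (n + 1))
  | none => {y | 0 < height y}
  | some a => {y | height y ≠ 1 ∧ (y ∈ cone n → retract y ∈ U a)}

open Classical in
/-- For each point an index such that the corresponding set of the suspended cover contains it. -/
noncomputable def suspIndex (y : SimplexSphere (n + 1)) : Option (SimplexSphere n) :=
  if 0 < height y then none else some (retract y)

theorem isOpen_suspSet (U : PtCover (SimplexSphere n)) (i : Option (SimplexSphere n)) :
    IsOpen (suspSet U.set i) := by
  cases i with
  | none => exact isOpen_lt continuous_const continuous_height
  | some a =>
    have h1 : IsOpen {y : SimplexSphere (n + 1) | height y ≠ 1} :=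
      isOpen_ne_fun continuous_height continuous_const
    rw [isOpen_iff_mem_nhds]
    rintro y ⟨hy1, hy2⟩
    by_cases hy : y ∈ cone n
    · have h2 := continuousOn_retract y ⟨hy, hy1⟩ |>.preimage_mem_nhdsWithin
        ((U.isOpen a).mem_nhds (hy2 hy))
      rw [mem_nhdsWithin_iff_eventually] at h2
      filter_upwards [h2, h1.mem_nhds hy1] with z hz hz1
      exact ⟨hz1, fun hzc => hz ⟨hzc, hz1⟩⟩
    · filter_upwards [h1.mem_nhds hy1, isClosed_cone.isOpen_compl.mem_nhds hy] with z hz hz'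
      exact ⟨hz, fun h => absurd h hz'⟩

/-- The suspended cover, indexed by points. -/
noncomputable def suspCover (U : PtCover (SimplexSphere n)) : PtCover (SimplexSphere (n + 1)) where
  set y := suspSet U.set (suspIndex y)
  isOpen _ := isOpen_suspSet U _
  mem y := by
    by_cases hy : 0 < height y
    · simp [suspIndex, hy, suspSet]
    · have h0 : height y = 0 := le_antisymm (not_lt.mp hy) (height_nonneg y)
      simp only [suspIndex, hy, if_false]
      exact ⟨by simp [h0], fun _ => U.mem _⟩

/-- The suspension of a zero-cochain: `g i ∘ p` at the indices `(i, none)`, extended to be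
antisymmetric, and trivial when `none` does not occur. -/
noncomputable def suspCochain0 {G : Type*} [Group G] (g : SimplexSphere n → SimplexSphere n → G) :
    Option (SimplexSphere n) → Option (SimplexSphere n) → SimplexSphere (n + 1) → G
  | some a, none => fun y => g a (retract y)
  | none, some a => fun y => (g a (retract y))⁻¹
  | _, _ => fun _ => 1

/-- The suspension of a one-cochain: `g i j ∘ p` at the indices `(i, j, none)`, extended to be
antisymmetric in the position of `none`, and trivial when `none` does not occur exactly once. -/
noncomputable def suspCochain1 {Z : Type*} [CommGroup Z]
    (g : SimplexSphere n → SimplexSphere n → SimplexSphere n → Z) :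
    Option (SimplexSphere n) → Option (SimplexSphere n) → Option (SimplexSphere n) →
      SimplexSphere (n + 1) → Z
  | some a, some b, none => fun y => g a b (retract y)
  | some a, none, some b => fun y => (g a b (retract y))⁻¹
  | none, some a, some b => fun y => g a b (retract y)
  | _, _, _ => fun _ => 1

theorem retract_mem {U : SimplexSphere n → Set (SimplexSphere n)} {a : SimplexSphere n}
    {y : SimplexSphere (n + 1)} (h : 0 < height y) (hy : y ∈ suspSet U (some a)) :
    retract y ∈ U a := hy.2 (mem_cone_of_height_pos h)

theorem continuousOn_comp_retract {G : Type*} [TopologicalSpace G] {g : SimplexSphere n → G}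
    {A : Set (SimplexSphere n)} (hg : ContinuousOn g A) {B : Set (SimplexSphere (n + 1))}
    (hB : ∀ y ∈ B, 0 < height y ∧ height y ≠ 1 ∧ retract y ∈ A) :
    ContinuousOn (fun y => g (retract y)) B :=
  hg.comp (continuousOn_retract.mono fun y hy =>
    ⟨mem_cone_of_height_pos (hB y hy).1, (hB y hy).2.1⟩) fun y hy => (hB y hy).2.2

theorem continuousOn_suspCochain0 {G : Type*} [Group G] [TopologicalSpace G]
    [IsTopologicalGroup G] {U : PtCover (SimplexSphere n)}
    {g : SimplexSphere n → SimplexSphere n → G} (hg : ∀ i, ContinuousOn (g i) (U.set i))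
    (i j : Option (SimplexSphere n)) :
    ContinuousOn (suspCochain0 g i j) (suspSet U.set i ∩ suspSet U.set j) := by
  rcases i with _ | a <;> rcases j with _ | b
  · exact continuousOn_const
  · exact (continuousOn_comp_retract (hg b) fun y hy =>
      ⟨hy.1, hy.2.1, retract_mem hy.1 hy.2⟩).inv
  · exact continuousOn_comp_retract (hg a) fun y hy =>
      ⟨hy.2, hy.1.1, retract_mem hy.2 hy.1⟩
  · exact continuousOn_const

theorem continuousOn_suspCochain1 {Z : Type*} [CommGroup Z] [TopologicalSpace Z]
    [IsTopologicalGroup Z] {U : PtCover (SimplexSphere n)}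
    {g : SimplexSphere n → SimplexSphere n → SimplexSphere n → Z}
    (hg : ∀ i j, ContinuousOn (g i j) (U.set i ∩ U.set j)) (i j k : Option (SimplexSphere n)) :
    ContinuousOn (suspCochain1 g i j k)
      (suspSet U.set i ∩ suspSet U.set j ∩ suspSet U.set k) := by
  rcases i with _ | a <;> rcases j with _ | b <;> rcases k with _ | c
  · exact continuousOn_const
  · exact continuousOn_const
  · exact continuousOn_const
  · exact continuousOn_comp_retract (hg b c) fun y hy =>
      ⟨hy.1.1, hy.2.1, retract_mem hy.1.1 hy.1.2, retract_mem hy.1.1 hy.2⟩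
  · exact continuousOn_const
  · exact (continuousOn_comp_retract (hg a c) fun y hy =>
      ⟨hy.1.2, hy.2.1, retract_mem hy.1.2 hy.1.1, retract_mem hy.1.2 hy.2⟩).inv
  · exact continuousOn_comp_retract (hg a b) fun y hy =>
      ⟨hy.2, hy.1.1.1, retract_mem hy.2 hy.1.1, retract_mem hy.2 hy.1.2⟩
  · exact continuousOn_const

theorem suspCochain0_mul {K : Type*} [Group K] (f : SimplexSphere n → K)
    (i j k : Option (SimplexSphere n)) (y : SimplexSphere (n + 1)) :
    suspCochain0 (fun _ => f) j k y * suspCochain0 (fun _ => f) i j y =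
      suspCochain0 (fun _ => f) i k y := by
  rcases i with _ | a <;> rcases j with _ | b <;> rcases k with _ | c <;> simp [suspCochain0]

theorem suspCochain1_mul {Z : Type*} [CommGroup Z] [TopologicalSpace Z]
    {U : PtCover (SimplexSphere n)}
    {g : SimplexSphere n → SimplexSphere n → SimplexSphere n → Z} (hg : IsCocycle1 U g)
    (i j k l : Option (SimplexSphere n)) (y : SimplexSphere (n + 1))
    (hy : y ∈ suspSet U.set i ∩ suspSet U.set j ∩ suspSet U.set k ∩ suspSet U.set l) :
    suspCochain1 g j k l y * (suspCochain1 g i k l y)⁻¹ * suspCochain1 g i j l y *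
      (suspCochain1 g i j k y)⁻¹ = 1 := by
  rcases i with _ | a <;> rcases j with _ | b <;> rcases k with _ | c <;> rcases l with _ | d
  case some.some.some.none =>
    have h := hg.2 a b c _ ⟨⟨retract_mem hy.2 hy.1.1.1, retract_mem hy.2 hy.1.1.2⟩,
      retract_mem hy.2 hy.1.2⟩
    simp [suspCochain1, ← h]
  case some.some.none.some =>
    have h := hg.2 a b d _ ⟨⟨retract_mem hy.1.2 hy.1.1.1, retract_mem hy.1.2 hy.1.1.2⟩,
      retract_mem hy.1.2 hy.2⟩
    simp [suspCochain1, ← h]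
  case some.none.some.some =>
    have h := hg.2 a c d _ ⟨⟨retract_mem hy.1.1.2 hy.1.1.1, retract_mem hy.1.1.2 hy.1.2⟩,
      retract_mem hy.1.1.2 hy.2⟩
    simp [suspCochain1, ← h]
  case none.some.some.some =>
    have h := hg.2 b c d _ ⟨⟨retract_mem hy.1.1.1 hy.1.1.2, retract_mem hy.1.1.1 hy.1.2⟩,
      retract_mem hy.1.1.1 hy.2⟩
    simp [suspCochain1, ← h]
  all_goals simp [suspCochain1]

/-- Cohomologous one-cocycles have suspensions which differ by a coboundary. -/
theorem suspCochain1_coboundary {Z : Type*} [CommGroup Z]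
    {U : PtCover (SimplexSphere n)}
    {g h : SimplexSphere n → SimplexSphere n → SimplexSphere n → Z}
    {b : SimplexSphere n → SimplexSphere n → Z}
    (hgh : ∀ i j, ∀ x ∈ U.set i ∩ U.set j, h i j x = (b j x)⁻¹ * g i j x * b i x)
    (i j k : Option (SimplexSphere n)) (y : SimplexSphere (n + 1))
    (hy : y ∈ suspSet U.set i ∩ suspSet U.set j ∩ suspSet U.set k) :
    (suspCochain1 g i j k y)⁻¹ * suspCochain1 h i j k y =
      (suspCochain0 b j k y)⁻¹ * ((suspCochain0 b i k y)⁻¹)⁻¹ * (suspCochain0 b i j y)⁻¹ := by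
  have comm : ∀ p q r : Z, q⁻¹ * (p⁻¹ * q * r) = p⁻¹ * r := fun p q r => by
    rw [mul_comm p⁻¹ q, mul_assoc q, inv_mul_cancel_left]
  rcases i with _ | i' <;> rcases j with _ | j' <;> rcases k with _ | k'
  case some.some.none =>
    have h := hgh i' j' _ ⟨retract_mem hy.2 hy.1.1, retract_mem hy.2 hy.1.2⟩
    simp [suspCochain1, suspCochain0, h, comm]
  case some.none.some =>
    have h := hgh i' k' _ ⟨retract_mem hy.1.2 hy.1.1, retract_mem hy.1.2 hy.2⟩
    simp only [suspCochain1, suspCochain0, h, inv_inv, mul_one]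
    rw [← inv_inj]
    simp only [mul_inv, inv_inv]
    simpa using comm (b k' (retract y)) (g i' k' (retract y)) (b i' (retract y))
  case none.some.some =>
    have h := hgh j' k' _ ⟨retract_mem hy.1.1 hy.1.2, retract_mem hy.1.1 hy.2⟩
    simp only [suspCochain1, suspCochain0, h, comm, inv_inv, inv_one, one_mul]
  all_goals simp [suspCochain1, suspCochain0]

/-- The suspension of a continuous map, as a one-cocycle. -/
noncomputable def suspCocycle0 {K : Type*} [Group K] [TopologicalSpace K] [IsTopologicalGroup K]
    (f : C(SimplexSphere n, K)) : Cocycle1 (SimplexSphere (n + 1)) K :=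
  ⟨fun i j => suspCochain0 (fun _ => f) (suspIndex i) (suspIndex j),
    suspCover ⟨fun _ => univ, fun _ => isOpen_univ, fun _ => mem_univ _⟩,
    fun _ _ => continuousOn_suspCochain0 (fun _ => f.continuous.continuousOn) _ _,
    fun _ _ _ _ _ => suspCochain0_mul _ _ _ _ _⟩

/-- The suspension map from `C(Sⁿ, K)` to the first cohomology of the next sphere. -/
noncomputable def susp₀ {K : Type*} [Group K] [TopologicalSpace K] [IsTopologicalGroup K]
    (f : C(SimplexSphere n, K)) : CechH1 (SimplexSphere (n + 1)) K :=
  CechH1.mk (suspCocycle0 f)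

section

variable {Z : Type*} [CommGroup Z] [TopologicalSpace Z] [IsTopologicalGroup Z]

/-- The suspension of a one-cocycle, as a two-cocycle. -/
noncomputable def suspCocycle1 (g : Cocycle1 (SimplexSphere n) Z) :
    Cocycle2 (SimplexSphere (n + 1)) Z :=
  ⟨fun i j k => suspCochain1 g.1 (suspIndex i) (suspIndex j) (suspIndex k), by
    obtain ⟨g, U, hg⟩ := g
    exact ⟨suspCover U, fun i j k => continuousOn_suspCochain1 hg.1 _ _ _,
      fun i j k l y hy => suspCochain1_mul hg _ _ _ _ y hy⟩⟩

/-- The suspension map in degree one. -/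
noncomputable def susp₁ (c : CechH1 (SimplexSphere n) Z) : CechH2 (SimplexSphere (n + 1)) Z :=
  Quotient.lift (s := cocycle1Setoid (SimplexSphere n) Z)
    (fun g => CechH2.mk (suspCocycle1 g)) (by
      rintro g h ⟨U, b, hb, hgh⟩
      exact CechH2.mk_eq_mk ⟨suspCover U,
        fun i j y => (suspCochain0 b (suspIndex i) (suspIndex j) y)⁻¹,
        fun i j => (continuousOn_suspCochain0 hb _ _).inv,
        fun i j k y hy => suspCochain1_coboundary hgh _ _ _ y hy⟩) c

end

/-! ### The clutched bundle -/

section Clutching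

variable {K : Type v} [Group K]

/-- The gluing relation of the clutching construction: over a point `x` of the equator, the
point `(x, 0, f x * k)` over the cone is identified with `(x, 1, k)` over the last face. -/
inductive ClutchRel (f : SimplexSphere n → K) :
    (cone n × K) ⊕ (face n × K) → (cone n × K) ⊕ (face n × K) → Prop
  | glue (x : SimplexSphere n) (k : K) :
      ClutchRel f (Sum.inl (⟨equator x, equator_mem_cone x⟩, f x * k))
        (Sum.inr (⟨equator x, equator_mem_face x⟩, k))

/-- The total space of the clutched bundle, a quotient of the disjoint union of the trivial
bundles over the two discs `cone n` and `face n`. -/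
def ClutchSpace (f : SimplexSphere n → K) : Type v := Quot (ClutchRel f)

variable (f : SimplexSphere n → K)

instance [TopologicalSpace K] : TopologicalSpace (ClutchSpace f) :=
  inferInstanceAs (TopologicalSpace (Quot (ClutchRel f)))

variable {f}

/-- The quotient map onto the clutched bundle. -/
def ClutchSpace.mk (p : (cone n × K) ⊕ (face n × K)) : ClutchSpace f := Quot.mk _ p

theorem ClutchSpace.isQuotientMap_mk [TopologicalSpace K] :
    IsQuotientMap (ClutchSpace.mk (f := f)) := isQuotientMap_quot_mk

theorem ClutchSpace.glue (x : SimplexSphere n) (k : K) :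
    ClutchSpace.mk (f := f) (Sum.inl (⟨equator x, equator_mem_cone x⟩, f x * k)) =
      ClutchSpace.mk (Sum.inr (⟨equator x, equator_mem_face x⟩, k)) :=
  Quot.sound (ClutchRel.glue x k)

/-- The projection of the clutched bundle. -/
def ClutchSpace.proj : ClutchSpace f → SimplexSphere (n + 1) :=
  Quot.lift (Sum.elim (fun p => p.1.1) (fun p => p.1.1)) (by rintro _ _ ⟨x, k⟩; rfl)

/-- The action of `K` from the right on the clutched bundle. -/
def ClutchSpace.act (p : ClutchSpace f) (g : K) : ClutchSpace f :=
  Quot.map (Sum.map (fun p => (p.1, p.2 * g)) (fun p => (p.1, p.2 * g)))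
    (by
      rintro _ _ ⟨x, k⟩
      simp only [Sum.map_inl, Sum.map_inr, mul_assoc]
      exact ClutchRel.glue x _) p

/-- The fibre coordinate over the star of the last vertex. -/
noncomputable def ClutchSpace.coordCone : ClutchSpace f → K :=
  Quot.lift (Sum.elim (fun p => p.2) (fun p => f (retract p.1.1) * p.2))
    (by rintro _ _ ⟨x, k⟩; simp [retract_equator])

/-- The fibre coordinate over the complement of the last vertex. -/
noncomputable def ClutchSpace.coordFace : ClutchSpace f → K :=
  Quot.lift (Sum.elim (fun p => (f (retract p.1.1))⁻¹ * p.2) (fun p => p.2))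
    (by rintro _ _ ⟨x, k⟩; simp [retract_equator])

theorem ClutchSpace.proj_act (p : ClutchSpace f) (g : K) :
    (p.act g).proj = p.proj := by
  rcases p with ⟨p | p⟩ <;> rfl

theorem ClutchSpace.coordCone_act (p : ClutchSpace f) (g : K) :
    (p.act g).coordCone = p.coordCone * g := by
  rcases p with ⟨p | p⟩
  · rfl
  · exact (mul_assoc _ _ _).symm

theorem ClutchSpace.coordFace_act (p : ClutchSpace f) (g : K) :
    (p.act g).coordFace = p.coordFace * g := by
  rcases p with ⟨p | p⟩
  · exact (mul_assoc _ _ _).symm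
  · rfl

open Classical in
/-- A section over the cone. -/
noncomputable def ClutchSpace.sectionCone (f : SimplexSphere n → K)
    (y : SimplexSphere (n + 1)) : ClutchSpace f :=
  if h : y ∈ cone n then mk (Sum.inl (⟨y, h⟩, 1))
  else mk (Sum.inr (⟨y, (cone_union_face y).resolve_left h⟩, 1))

open Classical in
/-- A section over the complement of the last vertex. -/
noncomputable def ClutchSpace.sectionFace (f : SimplexSphere n → K)
    (y : SimplexSphere (n + 1)) : ClutchSpace f :=
  if h : y ∈ face n then mk (Sum.inr (⟨y, h⟩, 1))
  else mk (Sum.inl (⟨y, (cone_union_face y).resolve_right h⟩, f (retract y)))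

theorem ClutchSpace.proj_sectionCone (y : SimplexSphere (n + 1)) :
    (sectionCone f y).proj = y := by
  unfold sectionCone
  split_ifs <;> rfl

theorem ClutchSpace.proj_sectionFace (y : SimplexSphere (n + 1)) :
    (sectionFace f y).proj = y := by
  unfold sectionFace
  split_ifs <;> rfl

theorem ClutchSpace.mk_inl_eq {y : SimplexSphere (n + 1)} (h : y ∈ cone n) (k : K) :
    mk (f := f) (Sum.inl (⟨y, h⟩, k)) = (sectionCone f y).act k := by
  rw [sectionCone, dif_pos h]
  change _ = mk (Sum.inl (⟨y, h⟩, 1 * k))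
  rw [one_mul]

theorem ClutchSpace.mk_inr_eq {y : SimplexSphere (n + 1)} (h : y ∈ face n) (k : K) :
    mk (f := f) (Sum.inr (⟨y, h⟩, k)) = (sectionFace f y).act k := by
  rw [sectionFace, dif_pos h]
  change _ = mk (Sum.inr (⟨y, h⟩, 1 * k))
  rw [one_mul]

theorem ClutchSpace.mk_inl_eq' {y : SimplexSphere (n + 1)} (h : y ∈ cone n) (k : K) :
    mk (f := f) (Sum.inl (⟨y, h⟩, f (retract y) * k)) = (sectionFace f y).act k := by
  by_cases h' : y ∈ face n
  · rw [← mk_inr_eq h']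
    have h1 := glue (f := f) (retract y) k
    simp only [equator_retract h h'] at h1
    exact h1
  · rw [sectionFace, dif_neg h']
    rfl

variable [TopologicalSpace K] [IsTopologicalGroup K]

theorem ClutchSpace.continuous_proj : Continuous (proj (f := f)) :=
  continuous_quot_lift _ (by fun_prop)

theorem ClutchSpace.continuousOn_sectionCone (f : C(SimplexSphere n, K)) :
    ContinuousOn (fun q : SimplexSphere (n + 1) × K => (sectionCone f q.1).act q.2)
      ({y | 0 < height y} ×ˢ univ) := by
  rw [continuousOn_iff_continuous_domRestrict]
  have h : Continuous fun q : ({y : SimplexSphere (n + 1) | 0 < height y} ×ˢ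
      (univ : Set K) : Set _) => ClutchSpace.mk (f := f)
        (Sum.inl (⟨q.1.1, mem_cone_of_height_pos q.2.1⟩, q.1.2)) :=
    ClutchSpace.isQuotientMap_mk.continuous.comp (by fun_prop)
  refine h.congr fun q => ?_
  exact ClutchSpace.mk_inl_eq _ _

theorem ClutchSpace.continuousOn_sectionFace (f : C(SimplexSphere n, K)) :
    ContinuousOn (fun q : SimplexSphere (n + 1) × K => (sectionFace f q.1).act q.2)
      ({y | height y ≠ 1} ×ˢ univ) := by
  have h1 : ContinuousOn (fun q : SimplexSphere (n + 1) × K =>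
      (ClutchSpace.sectionFace f q.1).act q.2)
      (({y | height y ≠ 1} ×ˢ univ) ∩ (Prod.fst ⁻¹' cone n)) := by
    rw [continuousOn_iff_continuous_domRestrict]
    have hr : Continuous fun q : (({y | height y ≠ 1} ×ˢ univ) ∩
        (Prod.fst ⁻¹' cone n) : Set (SimplexSphere (n + 1) × K)) => retract q.1.1 :=
      continuousOn_retract.comp_continuous (by fun_prop) fun q => ⟨q.2.2, q.2.1.1⟩
    have h : Continuous fun q : (({y | height y ≠ 1} ×ˢ univ) ∩
        (Prod.fst ⁻¹' cone n) : Set (SimplexSphere (n + 1) × K)) =>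
        ClutchSpace.mk (f := f)
          (Sum.inl (⟨q.1.1, q.2.2⟩, f (retract q.1.1) * q.1.2)) :=
      ClutchSpace.isQuotientMap_mk.continuous.comp (by fun_prop)
    exact h.congr fun q => ClutchSpace.mk_inl_eq' _ _
  have h2 : ContinuousOn (fun q : SimplexSphere (n + 1) × K =>
      (ClutchSpace.sectionFace f q.1).act q.2)
      (({y | height y ≠ 1} ×ˢ univ) ∩ (Prod.fst ⁻¹' face n)) := by
    rw [continuousOn_iff_continuous_domRestrict]
    have h : Continuous fun q : (({y | height y ≠ 1} ×ˢ univ) ∩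
        (Prod.fst ⁻¹' face n) : Set (SimplexSphere (n + 1) × K)) =>
        ClutchSpace.mk (f := f) (Sum.inr (⟨q.1.1, q.2.2⟩, q.1.2)) :=
      ClutchSpace.isQuotientMap_mk.continuous.comp (by fun_prop)
    exact h.congr fun q => ClutchSpace.mk_inr_eq _ _
  intro q hq
  have hc : IsClosed (Prod.fst ⁻¹' cone n : Set (SimplexSphere (n + 1) × K)) :=
    isClosed_cone.preimage continuous_fst
  have hf : IsClosed (Prod.fst ⁻¹' face n : Set (SimplexSphere (n + 1) × K)) :=
    isClosed_face.preimage continuous_fst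
  have key : ∀ C : Set (SimplexSphere (n + 1) × K), IsClosed C →
      ContinuousOn (fun q : SimplexSphere (n + 1) × K =>
        (ClutchSpace.sectionFace f q.1).act q.2) (({y | height y ≠ 1} ×ˢ univ) ∩ C) →
      ContinuousWithinAt (fun q : SimplexSphere (n + 1) × K =>
        (ClutchSpace.sectionFace f q.1).act q.2)
          (({y | height y ≠ 1} ×ˢ univ) ∩ C) q := by
    intro C hC h
    by_cases hqC : q ∈ C
    · exact h q ⟨hq, hqC⟩
    · refine continuousWithinAt_of_notMem_closure fun hmem => hqC ?_
      exact hC.closure_subset (closure_mono inter_subset_right hmem)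
  refine ((key _ hc h1).union (key _ hf h2)).mono fun z hz => ?_
  rcases cone_union_face z.1 with h | h
  · exact Or.inl ⟨hz, h⟩
  · exact Or.inr ⟨hz, h⟩

/-- The principal `K`-bundle over the sphere of dimension `n + 1` which is obtained from a
continuous map `f` on the equator by clutching. -/
def clutchedBundle (f : C(SimplexSphere n, K)) :
    PrincipalBundle (SimplexSphere (n + 1)) K where
  Total := ClutchSpace f
  act := ClutchSpace.act
  act_one p := by
    rcases p with ⟨⟨y, k⟩ | ⟨y, k⟩⟩
    · exact congrArg (fun k' => ClutchSpace.mk (Sum.inl (y, k'))) (mul_one k)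
    · exact congrArg (fun k' => ClutchSpace.mk (Sum.inr (y, k'))) (mul_one k)
  act_mul p g h := by
    rcases p with ⟨⟨y, k⟩ | ⟨y, k⟩⟩
    · exact congrArg (fun k' => ClutchSpace.mk (Sum.inl (y, k'))) (mul_assoc k g h).symm
    · exact congrArg (fun k' => ClutchSpace.mk (Sum.inr (y, k'))) (mul_assoc k g h).symm
  proj := ClutchSpace.proj
  isPrincipal := by
    intro y
    by_cases hy : 0 < height y
    · refine Exists.elim (exists_trivialization_of_section (act := ClutchSpace.act (f := f))
        ClutchSpace.continuous_proj ClutchSpace.proj_act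
        (isOpen_lt continuous_const continuous_height) (ClutchSpace.sectionCone f)
        ClutchSpace.coordCone (fun x _ => ClutchSpace.proj_sectionCone x) ?_ ?_ ?_ ?_
        fun p g _ => ClutchSpace.coordCone_act p g) fun e h => ⟨e, h.1 ▸ hy, h.2⟩
      · exact ClutchSpace.continuousOn_sectionCone f
      · rw [ClutchSpace.isQuotientMap_mk.continuousOn_isOpen_iff
          ((isOpen_lt continuous_const continuous_height).preimage ClutchSpace.continuous_proj)]
        rintro (p | p) hp
        · refine ContinuousAt.continuousWithinAt ?_
          refine (IsOpenEmbedding.inl.continuousAt_iff).mp ?_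
          exact continuous_snd.continuousAt
        · exact absurd (show height p.1.1 = 0 from p.1.2) (ne_of_gt hp)
      · intro x hx g
        rw [← ClutchSpace.mk_inl_eq (mem_cone_of_height_pos hx)]
        rfl
      · rintro ⟨⟨⟨x, hx⟩, k⟩ | ⟨⟨x, hx⟩, k⟩⟩ hp
        · exact (ClutchSpace.mk_inl_eq hx k).symm
        · exact absurd (show height x = 0 from hx) (ne_of_gt hp)
    · have hy1 : height y ≠ 1 := fun h => hy (h ▸ one_pos)
      have hB : IsOpen {y : SimplexSphere (n + 1) | height y ≠ 1} :=
        isOpen_ne_fun continuous_height continuous_const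
      refine Exists.elim (exists_trivialization_of_section (act := ClutchSpace.act (f := f))
        ClutchSpace.continuous_proj ClutchSpace.proj_act hB (ClutchSpace.sectionFace f)
        ClutchSpace.coordFace (fun x _ => ClutchSpace.proj_sectionFace x) ?_ ?_ ?_ ?_
        fun p g _ => ClutchSpace.coordFace_act p g) fun e h => ⟨e, h.1 ▸ hy1, h.2⟩
      · exact ClutchSpace.continuousOn_sectionFace f
      · rw [ClutchSpace.isQuotientMap_mk.continuousOn_isOpen_iff
          (hB.preimage ClutchSpace.continuous_proj)]
        rintro (p | p) hp
        · refine ContinuousAt.continuousWithinAt ?_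
          refine (IsOpenEmbedding.inl.continuousAt_iff).mp ?_
          have hr : ContinuousAt (fun p : cone n × K => retract p.1.1) p := by
            have hc : ContinuousOn (fun p : cone n × K => retract p.1.1)
                {p | height p.1.1 ≠ 1} :=
              continuousOn_retract.comp (by fun_prop) fun p hp => ⟨p.1.2, hp⟩
            refine hc.continuousAt (IsOpen.mem_nhds ?_ hp)
            exact hB.preimage (by fun_prop)
          exact (f.continuous.continuousAt.comp hr).inv.mul continuous_snd.continuousAt
        · refine ContinuousAt.continuousWithinAt ?_
          refine (IsOpenEmbedding.inr.continuousAt_iff).mp ?_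
          exact continuous_snd.continuousAt
      · intro x hx g
        rcases cone_union_face x with h | h
        · rw [← ClutchSpace.mk_inl_eq' h]
          exact inv_mul_cancel_left _ _
        · rw [← ClutchSpace.mk_inr_eq h]
          rfl
      · rintro ⟨⟨⟨x, hx⟩, k⟩ | ⟨⟨x, hx⟩, k⟩⟩ hp
        · refine (ClutchSpace.mk_inl_eq' hx _).symm.trans ?_
          change ClutchSpace.mk (Sum.inl (⟨x, hx⟩, f (retract x) * ((f (retract x))⁻¹ * k))) = _
          rw [mul_inv_cancel_left]
          rfl
        · exact (ClutchSpace.mk_inr_eq hx k).symm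

end Clutching

end SimplexSphere

/-! ### Classes computed from representatives, and the pulled back bundle. -/

section Classes

variable {X : Type*} [TopologicalSpace X] {Z : Type u} {K : Type v} [CommGroup Z]
  [TopologicalSpace Z] [IsTopologicalGroup Z] [Group K] [TopologicalSpace K]
  [IsTopologicalGroup K]

/-! The class of a bundle and the values of `δ₀` and `δ₁` are chosen among all classes with a
suitable representative, and the `unique` lemmas show that such a class does not depend on the
representative. Each of the three identities is therefore proved by exhibiting one convenient
representative.

For `δ₀ f = [f^* K̂]`, local lifts `f̂ i` of `f` are the same thing as local sections `x ↦ (x, f̂ i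
x)` of the fibre product. The cocycle `f̂ i * (f̂ j)⁻¹` is central, so it also satisfies `f̂ i = f̂
j * z i j`, which is the relation defining transition functions (`IsConnecting0.isClass_pullback`).

For `Σ₀ f = [P_f]`, cover the sphere by the star of the last vertex and the complement of that
vertex. The clutched bundle has a section over each, constant 1 over the cone and over the last face
respectively; the second one is continued from the face over the cone by the gluing rule, and
thereby becomes the first section times `f ∘ p`, where `p` is the radial retraction
(`sectionFace_eq`). These transition functions are literally the suspended cocycle
(`isClass_clutchedBundle`).

For `δ₁ [P_f] = -Σ₁ (δ₀ f)`, use the representative `Σ₀ f` of `[P_f]`. It is lifted by suspending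
the lifts of `f`: `ĝ` is `f̂ a ∘ p` at `(a, ∞)`, its inverse at `(∞, a)`, and 1 elsewhere. At `(a,
b, ∞)` the coboundary `ĝ j k * ĝ i j * (ĝ i k)⁻¹` is `f̂ b * (f̂ a)⁻¹`, composed with `p`. This is
the inverse of `z a b = f̂ a * (f̂ b)⁻¹`, whence the minus sign. The other positions of `∞` give the
matching signs by centrality (`incl_suspCochain1_inv`). The equality thus holds already for
cocycles, without any correction by a coboundary.

Covers are indexed by points, whereas suspended covers have the index type `Option`, with `none` for
`∞`. The computations are done for arbitrary indices in `Option` and then specialized along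
`suspIndex`. -/

theorem PrincipalBundle.isClass_cls {G : Type*} [Group G] [TopologicalSpace G]
    [IsTopologicalGroup G] (P : PrincipalBundle X G) : P.IsClass P.cls :=
  P.exists_isClass.choose_spec

theorem CentralExtension.isConnecting0_δ₀ (E : CentralExtension.{u, v, w} Z K) (f : C(X, K)) :
    E.IsConnecting0 f (E.δ₀ f) :=
  (E.exists_isConnecting0 f).choose_spec

theorem CentralExtension.isConnecting1_δ₁ [ParacompactSpace X] [T2Space X]
    (E : CentralExtension.{u, v, w} Z K) (c : CechH1 X K) : E.IsConnecting1 c (E.δ₁ c) :=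
  (E.exists_isConnecting1 c).choose_spec

/-- Local lifts of `f` are local sections of the pulled back bundle, so that both define the same
cohomology class. -/
theorem CentralExtension.IsConnecting0.isClass_pullback {E : CentralExtension.{u, v, w} Z K}
    {f : C(X, K)} {c : CechH1 X Z} (h : E.IsConnecting0 f c) : (E.pullback f).IsClass c := by
  classical
  obtain ⟨U, s, z, hz, hs, hsf, hsz, rfl⟩ := h
  -- Away from `U i` the function `s i` need not lift `f`. An arbitrary preimage of `f x` makes the
  -- section total there; its values play no role.
  let t : X → X → (E.pullback f).Total := fun i x =>
    if h : E.quot (s i x) = f x then ⟨(x, s i x), h⟩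
    else ⟨(x, (E.quot_surjective (f x)).choose), (E.quot_surjective (f x)).choose_spec⟩
  have ht : ∀ i, ∀ x, ∀ hx : x ∈ U.set i, t i x = ⟨(x, s i x), hsf i x hx⟩ :=
    fun i x hx => dif_pos (hsf i x hx)
  refine ⟨U, t, fun i => ?_, fun i x hx => ?_, z, hz, fun i j x hx => ?_, rfl⟩
  · refine (Topology.IsInducing.subtypeVal.continuousOn_iff).mpr ?_
    refine (continuousOn_id.prodMk (hs i)).congr fun x hx => ?_
    exact congrArg Subtype.val (ht i x hx)
  · rw [ht i x hx]
    rfl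
  · rw [ht i x hx.1, ht j x hx.2]
    refine Subtype.ext (Prod.ext rfl ?_)
    change s i x = s j x * E.incl (z.1 i j x)
    -- The cocycle is given by left division, the transition function by right division. Centrality
    -- of `Z` identifies the two.
    rw [← E.central, hsz i j x hx, inv_mul_cancel_right]

end Classes

/-! ### Local sections and transition functions of the clutched bundle. -/

namespace SimplexSphere

variable {n : ℕ} {Z : Type u} {K : Type v} [CommGroup Z] [TopologicalSpace Z]
  [IsTopologicalGroup Z] [Group K] [TopologicalSpace K] [IsTopologicalGroup K]

/-- The cover of the sphere by the star of the last vertex and the complement of the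
last vertex. -/
noncomputable def starCover (n : ℕ) : PtCover (SimplexSphere (n + 1)) :=
  suspCover ⟨fun _ => univ, fun _ => isOpen_univ, fun _ => mem_univ _⟩

/-- The sections of the clutched bundle over the two sets of the cover. -/
noncomputable def clutchSection (f : SimplexSphere n → K) :
    Option (SimplexSphere n) → SimplexSphere (n + 1) → ClutchSpace f
  | none => ClutchSpace.sectionCone f
  | some _ => ClutchSpace.sectionFace f

/-- Each section is the slice `k = 1` of the inverse of a local trivialization, `(y, k) ↦ σ y * k`,
whose joint continuity is known. The sets of a suspended cover lie in the star of the last vertex or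
in the complement of that vertex, whatever `U` is. -/
theorem continuousOn_clutchSection (f : C(SimplexSphere n, K)) (U : PtCover (SimplexSphere n))
    (i : Option (SimplexSphere n)) :
    ContinuousOn (clutchSection f i) (suspSet U.set i) := by
  have hact : ∀ p : ClutchSpace f, p.act 1 = p := (clutchedBundle f).act_one
  cases i with
  | none =>
    have h := (ClutchSpace.continuousOn_sectionCone f).comp
      (f := fun y : SimplexSphere (n + 1) => (y, (1 : K))) (s := suspSet U.set none)
      (by fun_prop) fun y hy => ⟨hy, mem_univ _⟩
    exact h.congr fun y _ => (hact _).symm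
  | some a =>
    have h := (ClutchSpace.continuousOn_sectionFace f).comp
      (f := fun y : SimplexSphere (n + 1) => (y, (1 : K))) (s := suspSet U.set (some a))
      (by fun_prop) fun y hy => ⟨hy.1, mem_univ _⟩
    exact h.congr fun y _ => (hact _).symm

theorem proj_clutchSection (f : SimplexSphere n → K) (i : Option (SimplexSphere n))
    (y : SimplexSphere (n + 1)) : (clutchSection f i y).proj = y := by
  cases i with
  | none => exact ClutchSpace.proj_sectionCone y
  | some a => exact ClutchSpace.proj_sectionFace y

/-- Over the cone, the two sections of the clutched bundle differ by `f ∘ retract`. -/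
theorem sectionFace_eq (f : C(SimplexSphere n, K)) {y : SimplexSphere (n + 1)}
    (hy : y ∈ cone n) :
    ClutchSpace.sectionFace f y = (ClutchSpace.sectionCone f y).act (f (retract y)) := by
  -- Both sides are the class of `(y, f (retract y))` in the trivial bundle over the cone. At the
  -- last vertex `retract` takes its default value on both sides, so that no exception is needed.
  rw [← ClutchSpace.mk_inl_eq hy]
  have h := ClutchSpace.mk_inl_eq' (f := f) hy 1
  rw [mul_one] at h
  exact ((clutchedBundle f).act_one _).symm.trans h.symm

/-- The section does not depend on `a` at an index `some a`, so the transition function is 1 unless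
exactly one index is `none`. In a mixed overlap the height is positive, hence the point lies in the
cone and `sectionFace_eq` or its inverse applies. The convention `s i = s j • g i j` is what puts `f
∘ p`, and not its inverse, at `(some a, none)`. -/
theorem clutchSection_eq (f : C(SimplexSphere n, K)) (U : PtCover (SimplexSphere n))
    (i j : Option (SimplexSphere n)) (y : SimplexSphere (n + 1))
    (hy : y ∈ suspSet U.set i ∩ suspSet U.set j) :
    clutchSection f i y = (clutchSection f j y).act (suspCochain0 (fun _ => f) i j y) := by
  have hact : ∀ p : ClutchSpace f, p.act 1 = p := (clutchedBundle f).act_one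
  have hmul : ∀ (p : ClutchSpace f) (g h : K), p.act (g * h) = (p.act g).act h :=
    (clutchedBundle f).act_mul
  rcases i with _ | a <;> rcases j with _ | b
  · exact (hact _).symm
  · change ClutchSpace.sectionCone f y =
      (ClutchSpace.sectionFace f y).act (f (retract y))⁻¹
    rw [sectionFace_eq f (mem_cone_of_height_pos hy.1), ← hmul, mul_inv_cancel, hact]
  · exact sectionFace_eq f (mem_cone_of_height_pos hy.2)
  · exact (hact _).symm

/-- The suspension of `f` is the class of the clutched bundle. -/
theorem isClass_clutchedBundle (f : C(SimplexSphere n, K)) :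
    (clutchedBundle f).IsClass (susp₀ f) :=
  -- `f` is defined on the whole equator, so the one-set cover of the equator suffices. Its
  -- suspension has only two distinct sets, although it is indexed by points.
  ⟨starCover n, fun i => clutchSection f (suspIndex i),
    fun _ => continuousOn_clutchSection f _ _, fun _ _ _ => proj_clutchSection f _ _,
    suspCocycle0 f,
    ⟨fun _ _ => continuousOn_suspCochain0 (fun _ => f.continuous.continuousOn) _ _,
      fun _ _ _ _ _ => suspCochain0_mul _ _ _ _ _⟩,
    fun _ _ _ hy => clutchSection_eq f _ _ _ _ hy, rfl⟩

/-! ### The connecting map on a suspended cocycle, and the sign. -/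

/-- The suspended lifts of `f` lift the suspension of `f`. -/
theorem quot_suspCochain0 {E : CentralExtension.{u, v, w} Z K} {f : C(SimplexSphere n, K)}
    {U : PtCover (SimplexSphere n)} {s : SimplexSphere n → SimplexSphere n → E.Ext}
    (hs : ∀ i, ∀ x ∈ U.set i, E.quot (s i x) = f x) (i j : Option (SimplexSphere n))
    (y : SimplexSphere (n + 1)) (hy : y ∈ suspSet U.set i ∩ suspSet U.set j) :
    E.quot (suspCochain0 s i j y) = suspCochain0 (fun _ => f) i j y := by
  rcases i with _ | a <;> rcases j with _ | b
  · exact map_one _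
  · change E.quot (s b (retract y))⁻¹ = (f (retract y))⁻¹
    rw [map_inv, hs b _ (retract_mem hy.1 hy.2)]
  · exact hs a _ (retract_mem hy.2 hy.1)
  · exact map_one _

/-- The coboundary of the suspended lifts is the inverse of the suspension of their differences. -/
theorem incl_suspCochain1_inv {E : CentralExtension.{u, v, w} Z K}
    {U : PtCover (SimplexSphere n)} {s : SimplexSphere n → SimplexSphere n → E.Ext}
    {z : SimplexSphere n → SimplexSphere n → SimplexSphere n → Z}
    (hz : ∀ i j, ∀ x ∈ U.set i ∩ U.set j, E.incl (z i j x) = s i x * (s j x)⁻¹)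
    (i j k : Option (SimplexSphere n)) (y : SimplexSphere (n + 1))
    (hy : y ∈ suspSet U.set i ∩ suspSet U.set j ∩ suspSet U.set k) :
    E.incl (suspCochain1 z i j k y)⁻¹ =
      suspCochain0 s j k y * suspCochain0 s i j y * (suspCochain0 s i k y)⁻¹ := by
  -- When `none` is not the last index, the lifts meet with the inverse on the left, as in `(s b)⁻¹
  -- * s a`. Since the difference of two lifts is central, it is the same element in either order.
  have comm : ∀ i j, ∀ x ∈ U.set i ∩ U.set j, E.incl (z i j x) = (s j x)⁻¹ * s i x := by
    intro i j x hx
    have h := E.central (z i j x) (s j x)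
    rw [hz i j x hx, inv_mul_cancel_right] at h
    rw [hz i j x hx, eq_inv_mul_iff_mul_eq]
    exact h.symm
  rcases i with _ | i' <;> rcases j with _ | j' <;> rcases k with _ | k'
  -- The coboundary is `s j' * 1 * (s i')⁻¹`, the inverse of `z i' j'`, everything composed with
  -- `retract`.
  case some.some.none =>
    have h := hz i' j' _ ⟨retract_mem hy.2 hy.1.1, retract_mem hy.2 hy.1.2⟩
    simp [suspCochain1, suspCochain0, h]
  -- Here the coboundary is `(s k')⁻¹ * s i'`, which is `z i' k'` itself; the suspension already
  -- carries an inverse in this position.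
  case some.none.some =>
    have h := comm i' k' _ ⟨retract_mem hy.1.2 hy.1.1, retract_mem hy.1.2 hy.2⟩
    simp [suspCochain1, suspCochain0, h]
  -- Here it is `(s j')⁻¹ * s k'`, again the inverse of `z j' k'`.
  case none.some.some =>
    have h := comm j' k' _ ⟨retract_mem hy.1.1 hy.1.2, retract_mem hy.1.1 hy.2⟩
    simp [suspCochain1, suspCochain0, h]
  -- If `none` occurs not at all or more than once, the lifts cancel and both sides are 1.
  all_goals simp [suspCochain1, suspCochain0]

/-- The connecting map turns the suspension of `f` into the negative of the suspension of its image
under the connecting map. -/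
theorem isConnecting1_susp₀ {E : CentralExtension.{u, v, w} Z K} {f : C(SimplexSphere n, K)}
    {c : CechH1 (SimplexSphere n) Z} (h : E.IsConnecting0 f c) :
    E.IsConnecting1 (susp₀ f) (-susp₁ c) := by
  obtain ⟨U, s, z, hz, hs, hsf, hsz, rfl⟩ := h
  -- The lifts exist only over the sets of `U`, so the suspension of `U` replaces the two-set cover.
  -- The cocycle representing `susp₀ f` stays the same function: it is also a cocycle on this cover,
  -- and no change of representative is needed. Inversion of cocycles becomes the minus sign in the
  -- additively written cohomology group.
  refine ⟨suspCover U, suspCocycle0 f,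
    fun i j => suspCochain0 s (suspIndex i) (suspIndex j), (suspCocycle1 z)⁻¹,
    ⟨fun _ _ => continuousOn_suspCochain0 (fun _ => f.continuous.continuousOn) _ _,
      fun _ _ _ _ _ => suspCochain0_mul _ _ _ _ _⟩, rfl,
    fun _ _ => continuousOn_suspCochain0 hs _ _,
    fun _ _ _ hy => quot_suspCochain0 hsf _ _ _ hy,
    ⟨fun _ _ _ => (continuousOn_suspCochain1 hz.1 _ _ _).inv, fun i j k l y hy => ?_⟩,
    fun _ _ _ _ hy => incl_suspCochain1_inv hsz _ _ _ _ hy, rfl⟩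
  have h := congrArg (·⁻¹) (suspCochain1_mul hz (suspIndex i) (suspIndex j) (suspIndex k)
    (suspIndex l) y hy)
  simp only [mul_inv, inv_one] at h
  exact h

end SimplexSphere

theorem proposition4 {Z : Type u} [CommGroup Z] [TopologicalSpace Z] [IsTopologicalGroup Z]
    {K : Type v} [Group K] [TopologicalSpace K] [IsTopologicalGroup K]
    (E : CentralExtension.{u, v, w} Z K) (n : ℕ) (f : C(SimplexSphere n, K)) :
    SimplexSphere.susp₀ f = (SimplexSphere.clutchedBundle f).cls ∧
    E.δ₁ (SimplexSphere.clutchedBundle f).cls = -SimplexSphere.susp₁ (E.δ₀ f) ∧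
    E.δ₀ f = (E.pullback f).cls := by
  have h0 := E.isConnecting0_δ₀ f
  have h1 : SimplexSphere.susp₀ f = (SimplexSphere.clutchedBundle f).cls :=
    (SimplexSphere.isClass_clutchedBundle f).unique (PrincipalBundle.isClass_cls _)
  refine ⟨h1, ?_, h0.isClass_pullback.unique (PrincipalBundle.isClass_cls _)⟩
  -- `δ₁` is evaluated on the explicit suspended cocycle, for which a lift is at hand, instead of on
  -- the chosen class of the bundle.
  rw [← h1]
  exact (E.isConnecting1_δ₁ _).unique (SimplexSphere.isConnecting1_susp₀ h0)
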